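/- Let $F$ be an algebraically closed field, $0\neq q\in F$ and $f,g\in F[h]$. Let $H_q(f,g)$ be the unital associative $F$-algebra generated by $x,y,h$ with relations $hx=xf(h)$, $yh=f(h)y$, $yx-qxy=g(h)$. Let $S_f$ be the set of all $\lambda:\mathbb Z\to F$ with $f(\lambda(i))=\lambda(i+1)$ for all $i\in\mathbb Z$, and for $\lambda\in S_f$ let $|\lambda|\ge 0$ be the integer with $|\lambda|\mathbb Z=\{k\in\mathbb Z\mid \lambda(i)=\lambda(i+k)\text{ for all }i\in\mathbb Z\}$. For $\lambda\in S_f$ let $T_\lambda$ be the set of all $\mu:\mathbb Z\to F$ with $\mu(i+1)=q\mu(i)+g(\lambda(i))$ for all $i\in\mathbb Z$, and for $\mu\in T_\lambda$ let $|\mu|\ge 0$ be the integer with $|\mu|\mathbb Z=\{k\in\mathbb Z\mid \mu(k|\lambda|)=\mu(0)\}$. For $\lambda\in S_f$ and $\mu\in T_\lambda$ let $A(\lambda,\mu)$ and $B(\lambda,\mu)$ be the $H_q(f,g)$-modules with underlying space $F[t^{\pm1}]$ and the actions $$A(\lambda,\mu):\quad ht^i=\lambda(i)t^i,\quad xt^i=t^{i+1},\quad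 yt^i=\mu(i)t^{i-1}\qquad(i\in\mathbb Z),$$ $$B(\lambda,\mu):\quad ht^i=\lambda(i)t^i,\quad xt^i=\mu(i+1)t^{i+1},\quad yt^i=t^{i-1}\qquad(i\in\mathbb Z).$$ For $\alpha\in F$ define $\nu_\alpha(0)=0$ and $\nu_\alpha(i+1)=q\nu_\alpha(i)+g(f^{(i)}(\alpha))$ for $i\ge0$, where $f^{(i)}(\alpha)$ is the $i$-th iterate of $f$ at $\alpha$, and let $C_\alpha$ be the $H_q(f,g)$-module with underlying space $F[t]$ and the action $ht^i=f^{(i)}(\alpha)t^i$, $xt^i=t^{i+1}$ for $i\geq 0$, $yt^i=\nu_\alpha(i)t^{i-1}$ for $i\ge1$, and $y\cdot 1=0$. Let $n\ge1$. The following modules are simple and $n$-dimensional: (a) $A(\lambda,\mu)/F[t^{\pm1}](t^{|\lambda||\mu|}-\gamma)$ for $\lambda\in S_f$, $\mu\in T_\lambda$ and $\gamma\in F^*$ such that $n=|\lambda||\mu|$; (b) $B(\lambda,\mu)/F[t^{\pm1}](t^{|\lambda||\mu|}-\gamma)$ for $\lambda\in S_f$, $\mu\in T_\lambda$ and $\gamma\in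 F^*$ such that $n=|\lambda||\mu|$ and $\mu(i)=0$ for some $0\le i<|\lambda||\mu|$; (c) $C_\alpha/F[t]t^n$ for $\alpha\in F$ such that $\nu_\alpha(i)\ne0$ for all $1\le i\le n-1$ and $\nu_\alpha(n)=0$. Every simple $n$-dimensional $H_q(f,g)$-module is isomorphic to a module of exactly one of the three lists (a), (b), (c). Within a list the module is unique in the following sense: two modules in (a), or two modules in (b), with parameters $(\lambda,\mu,\gamma)$ and $(\lambda',\mu',\gamma')$ are isomorphic if and only if $\gamma=\gamma'$ and there is $j\in\mathbb Z$ with $\lambda'(i)=\lambda(i+j)$ and $\mu'(i)=\mu(i+j)$ for all $i\in\mathbb Z$; two modules in (c) with parameters $\alpha$ and $\alpha'$ are isomorphic if and only if $\alpha=\alpha'$. -/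

import Mathlib

open Polynomial
open scoped LaurentPolynomial

universe u v

namespace QGHA

noncomputable section

/-! ### The quantum generalized Heisenberg algebra -/

/-- The three generators. -/
inductive Gen : Type
  | x
  | y
  | h

/-- The defining relations `h x = x f(h)`, `y h = f(h) y`, `y x - q x y = g(h)`. -/
inductive Rel {F : Type u} [Field F] (q : F) (f g : F[X]) :
    FreeAlgebra F Gen → FreeAlgebra F Gen → Prop
  | hx : Rel q f g (FreeAlgebra.ι F Gen.h * FreeAlgebra.ι F Gen.x)
      (FreeAlgebra.ι F Gen.x * aeval (FreeAlgebra.ι F Gen.h) f)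
  | yh : Rel q f g (FreeAlgebra.ι F Gen.y * FreeAlgebra.ι F Gen.h)
      (aeval (FreeAlgebra.ι F Gen.h) f * FreeAlgebra.ι F Gen.y)
  | yx : Rel q f g (FreeAlgebra.ι F Gen.y * FreeAlgebra.ι F Gen.x
        - q • (FreeAlgebra.ι F Gen.x * FreeAlgebra.ι F Gen.y))
      (aeval (FreeAlgebra.ι F Gen.h) g)

/-- The algebra `H_q(f,g)`. -/
def Alg {F : Type u} [Field F] (q : F) (f g : F[X]) : Type u := RingQuot (Rel q f g)

section Basic

variable {F : Type u} [Field F] {q : F} {f g : F[X]}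

instance : Ring (Alg q f g) := inferInstanceAs (Ring (RingQuot (Rel q f g)))

instance : Algebra F (Alg q f g) := inferInstanceAs (Algebra F (RingQuot (Rel q f g)))

/-- The canonical projection from the free algebra. -/
def proj (q : F) (f g : F[X]) : FreeAlgebra F Gen →ₐ[F] Alg q f g :=
  RingQuot.mkAlgHom F (Rel q f g)

/-- The generator `a` as an element of `H_q(f,g)`. -/
def gen (q : F) (f g : F[X]) (a : Gen) : Alg q f g := proj q f g (FreeAlgebra.ι F a)

variable {V : Type*} [AddCommGroup V] [Module F V]

/-- The triple `(X, Y, H)` of operators as a function on the generators. -/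
def ops (X Y H : Module.End F V) : Gen → Module.End F V
  | Gen.x => X
  | Gen.y => Y
  | Gen.h => H

/-- The representation of `H_q(f,g)` given by operators that satisfy the relations. -/
def rep (q : F) (f g : F[X]) (X Y H : Module.End F V)
    (hx : H * X = X * aeval H f) (yh : Y * H = aeval H f * Y)
    (yx : Y * X - q • (X * Y) = aeval H g) : Alg q f g →ₐ[F] Module.End F V :=
  RingQuot.liftAlgHom F ⟨FreeAlgebra.lift F (ops X Y H), by
    intro a b hab
    cases hab with
    | hx => simpa [← Polynomial.aeval_algHom_apply, ops] using hx
    | yh => simpa [← Polynomial.aeval_algHom_apply, ops] using yh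
    | yx => simpa [← Polynomial.aeval_algHom_apply, ops] using yx⟩

theorem rep_gen (X Y H : Module.End F V)
    (hx : H * X = X * aeval H f) (yh : Y * H = aeval H f * Y)
    (yx : Y * X - q • (X * Y) = aeval H g) (a : Gen) :
    rep q f g X Y H hx yh yx (gen q f g a) = ops X Y H a := by
  unfold rep gen proj
  erw [RingQuot.liftAlgHom_mkAlgHom_apply]
  simp

/-- A subspace stable under the three generators is stable under the algebra. -/
theorem stable_of_gen (ρ : Alg q f g →ₐ[F] Module.End F V) (K : Submodule F V)
    (hK : ∀ a, ∀ v ∈ K, ρ (gen q f g a) v ∈ K) (c : Alg q f g) (v : V) (hv : v ∈ K) :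
    ρ c v ∈ K := by
  obtain ⟨c, rfl⟩ := RingQuot.mkAlgHom_surjective F (Rel q f g) c
  change ρ (proj q f g c) v ∈ K
  induction c using FreeAlgebra.induction generalizing v with
  | grade0 r => simpa [Module.algebraMap_end_apply] using K.smul_mem r hv
  | grade1 a => exact hK a v hv
  | mul a b ha hb => rw [map_mul, map_mul]; exact ha _ (hb _ hv)
  | add a b ha hb => rw [map_add, map_add]; exact K.add_mem (ha _ hv) (hb _ hv)

theorem aeval_apply_of_eigen (H : Module.End F V) (v : V) (c : F) (hv : H v = c • v) (p : F[X]) :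
    aeval H p v = p.eval c • v := by
  induction p using Polynomial.induction_on' with
  | add p r hp hr => simp [hp, hr, add_smul]
  | monomial k a =>
    have : ∀ m : ℕ, (H ^ m) v = c ^ m • v := by
      intro m
      induction m with
      | zero => simp
      | succ m ih => rw [pow_succ', Module.End.mul_apply, ih, map_smul, hv, smul_smul, pow_succ]
    simp [Polynomial.aeval_monomial, this, smul_smul, Module.algebraMap_end_apply, mul_comm]

end Basic

/-! ### The parameters `λ`, `μ` and their periods -/

section Param

variable {F : Type u} [Field F]

/-- The set of `λ : ℤ → F` with `f(λ(i)) = λ(i+1)` for all `i`. -/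
def SF (f : F[X]) : Set (ℤ → F) := {lam | ∀ i, f.eval (lam i) = lam (i + 1)}

/-- The set of `μ : ℤ → F` with `μ(i+1) = q μ(i) + g(λ(i))` for all `i`. -/
def TF (q : F) (g : F[X]) (lam : ℤ → F) : Set (ℤ → F) :=
  {mu | ∀ i, mu (i + 1) = q * mu i + g.eval (lam i)}

/-- `|λ|`: the least positive period of `λ`, or `0` if there is none. -/
def lamPer (lam : ℤ → F) : ℕ := sInf {k : ℕ | 0 < k ∧ ∀ i, lam i = lam (i + k)}

/-- `|μ|`: the least `k > 0` with `μ(k|λ|) = μ(0)`, or `0` if there is none. -/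
def muPer (lam mu : ℤ → F) : ℕ := sInf {k : ℕ | 0 < k ∧ mu (k * lamPer lam) = mu 0}

/-- `|λ||μ|`. -/
def per (lam mu : ℤ → F) : ℕ := lamPer lam * muPer lam mu

/-- The least positive element (or `0`) of a subgroup of `ℤ` generates it. -/
theorem dvd_sInf_iff (P : AddSubgroup ℤ) (k : ℤ) :
    ((sInf {k : ℕ | 0 < k ∧ (k : ℤ) ∈ P} : ℕ) : ℤ) ∣ k ↔ k ∈ P := by
  set d := sInf {k : ℕ | 0 < k ∧ (k : ℤ) ∈ P} with hd
  rcases Set.eq_empty_or_nonempty {k : ℕ | 0 < k ∧ (k : ℤ) ∈ P} with h0 | h0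
  · have hd0 : d = 0 := by rw [hd, h0, Nat.sInf_empty]
    rw [hd0, Nat.cast_zero, zero_dvd_iff]
    refine ⟨fun h => h ▸ P.zero_mem, fun h => ?_⟩
    by_contra hk
    have : k.natAbs ∈ {k : ℕ | 0 < k ∧ (k : ℤ) ∈ P} := by
      refine ⟨Int.natAbs_pos.2 hk, ?_⟩
      rcases Int.natAbs_eq k with h1 | h1
      · rwa [← h1]
      · rw [show (k.natAbs : ℤ) = -k by omega]
        exact P.neg_mem h
    rw [h0] at this
    exact this
  · obtain ⟨hpos, hmem⟩ : 0 < d ∧ (d : ℤ) ∈ P := Nat.sInf_mem h0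
    have hmul : ∀ m : ℤ, (d : ℤ) * m ∈ P := fun m => by
      rw [mul_comm, ← smul_eq_mul]
      exact P.zsmul_mem hmem m
    refine ⟨fun ⟨m, hm⟩ => hm ▸ hmul m, fun h => ?_⟩
    have hr : k % d ∈ P := by
      rw [Int.emod_def]
      exact P.sub_mem h (hmul _)
    have h1 := Int.emod_nonneg k (b := (d : ℤ)) (by omega)
    have h2 := Int.emod_lt_of_pos k (b := (d : ℤ)) (by omega)
    by_contra hk
    have h3 : k % d ≠ 0 := fun h => hk (Int.dvd_of_emod_eq_zero h)
    have h4 : (k % d).toNat ∈ {k : ℕ | 0 < k ∧ (k : ℤ) ∈ P} := by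
      refine ⟨by omega, ?_⟩
      rwa [Int.toNat_of_nonneg h1]
    have h5 : d ≤ (k % d).toNat := Nat.sInf_le h4
    omega

set_option linter.unusedSectionVars false in
/-- `|λ|ℤ` is the group of periods of `λ`. -/
theorem lamPer_dvd_iff (lam : ℤ → F) (k : ℤ) :
    (lamPer lam : ℤ) ∣ k ↔ ∀ i, lam i = lam (i + k) :=
  dvd_sInf_iff
    { carrier := {k : ℤ | ∀ i, lam i = lam (i + k)}
      zero_mem' := fun i => by simp
      add_mem' := fun {a b} ha hb i => by rw [ha i, hb (i + a), add_assoc]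
      neg_mem' := fun {a} ha i => by rw [ha (i + -a), neg_add_cancel_right] } k

/-- A period of `λ` that preserves `μ(0)` is a period of `μ`. -/
theorem mu_periodic {q : F} {g : F[X]} {lam mu : ℤ → F} (hmu : mu ∈ TF q g lam) (d : ℤ)
    (hd : ∀ i, lam i = lam (i + d)) (h0 : mu d = mu 0) (i : ℤ) : mu (i + d) = mu i := by
  by_cases hq : q = 0
  · have h1 := hmu (i - 1 + d)
    have h2 := hmu (i - 1)
    rw [hq, zero_mul, zero_add, ← hd] at h1
    rw [hq, zero_mul, zero_add] at h2
    rw [show i - 1 + d + 1 = i + d by ring] at h1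
    rw [show i - 1 + 1 = i by ring] at h2
    rw [h1, h2]
  · induction i using Int.induction_on with
    | zero => simpa using h0
    | succ i ih =>
      rw [show (i : ℤ) + 1 + d = i + d + 1 by ring, hmu, hmu, ih, ← hd]
    | pred i ih =>
      have h1 := hmu (-(i : ℤ) - 1 + d)
      have h2 := hmu (-(i : ℤ) - 1)
      rw [← hd, show -(i : ℤ) - 1 + d + 1 = -(i : ℤ) + d by ring, ih] at h1
      rw [show -(i : ℤ) - 1 + 1 = -(i : ℤ) by ring, h1] at h2
      exact mul_left_cancel₀ hq (add_right_cancel h2)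

/-- `|μ|ℤ` is the set of all `k` with `μ(k|λ|) = μ(0)`. -/
theorem muPer_dvd_iff {q : F} {g : F[X]} {lam mu : ℤ → F} (hmu : mu ∈ TF q g lam) (k : ℤ) :
    (muPer lam mu : ℤ) ∣ k ↔ mu (k * lamPer lam) = mu 0 := by
  have hl : ∀ k : ℤ, ∀ i, lam i = lam (i + k * lamPer lam) := fun k =>
    (lamPer_dvd_iff lam _).1 (Dvd.intro_left _ rfl)
  exact dvd_sInf_iff
    { carrier := {k : ℤ | mu (k * lamPer lam) = mu 0}
      zero_mem' := by simp
      add_mem' := fun {a b} ha hb => by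
        change mu ((a + b) * lamPer lam) = mu 0
        rw [add_mul, mu_periodic hmu _ (hl b) hb]
        exact ha
      neg_mem' := fun {a} ha => by
        have := mu_periodic hmu _ (hl a) ha (-a * lamPer lam)
        rw [neg_mul, neg_add_cancel] at this
        change mu (-a * lamPer lam) = mu 0
        rw [neg_mul, this] } k

theorem lam_add_per (lam mu : ℤ → F) (i : ℤ) : lam (i + per lam mu) = lam i :=
  ((lamPer_dvd_iff lam _).1 (by rw [per, Nat.cast_mul]; exact Dvd.intro _ rfl) i).symm

theorem mu_add_per {q : F} {g : F[X]} {lam mu : ℤ → F} (hmu : mu ∈ TF q g lam) (i : ℤ) :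
    mu (i + per lam mu) = mu i := by
  refine mu_periodic hmu _ (fun i => (lam_add_per lam mu i).symm) ?_ i
  rw [per, Nat.cast_mul, mul_comm]
  exact (muPer_dvd_iff hmu _).1 dvd_rfl

end Param

/-! ### Operators on Laurent polynomials and on polynomials -/

section Operators

variable {F : Type u} [Field F]

/-- The linear map of `F[t, t⁻¹]` with `t^i ↦ c(i) t^(i+s)`. -/
def lop (c : ℤ → F) (s : ℤ) : Module.End F F[T;T⁻¹] :=
  (AddMonoidAlgebra.basis ℤ F).constr F fun i => c i • LaurentPolynomial.T (i + s)

theorem lop_T (c : ℤ → F) (s i : ℤ) :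
    lop c s (LaurentPolynomial.T i) = c i • LaurentPolynomial.T (i + s) := by
  have := (AddMonoidAlgebra.basis ℤ F).constr_basis F
    (fun i => c i • (LaurentPolynomial.T (i + s) : F[T;T⁻¹])) i
  rwa [AddMonoidAlgebra.basis_apply] at this

theorem lend_ext {E E' : Module.End F F[T;T⁻¹]}
    (h : ∀ i, E (LaurentPolynomial.T i) = E' (LaurentPolynomial.T i)) : E = E' :=
  (AddMonoidAlgebra.basis ℤ F).ext fun i => by
    rw [AddMonoidAlgebra.basis_apply]
    exact h i

/-- To be stable under a linear map, the ideal generated by `p` need only contain the images of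
the `t^i p`. -/
theorem lstable (E : Module.End F F[T;T⁻¹]) (p : F[T;T⁻¹])
    (h : ∀ i, E (LaurentPolynomial.T i * p) ∈ Ideal.span {p}) (v : F[T;T⁻¹])
    (hv : v ∈ Ideal.span {p}) : E v ∈ Ideal.span {p} := by
  obtain ⟨a, rfl⟩ := Ideal.mem_span_singleton'.1 hv
  clear hv
  induction a using LaurentPolynomial.induction_on' with
  | add a b ha hb => rw [add_mul, map_add]; exact Ideal.add_mem _ ha hb
  | C_mul_T i c =>
    rw [mul_assoc, ← LaurentPolynomial.smul_eq_C_mul, map_smul, LaurentPolynomial.smul_eq_C_mul]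
    exact Ideal.mul_mem_left _ _ (h i)

/-- The ideal generated by `t^N - γ` is stable under `t^i ↦ c(i) t^(i+s)` if `c` has period `N`. -/
theorem lop_stable (c : ℤ → F) (s : ℤ) (N : ℕ) (hc : ∀ i, c (i + N) = c i) (γ : F)
    (v : F[T;T⁻¹])
    (hv : v ∈ Ideal.span {(LaurentPolynomial.T N - LaurentPolynomial.C γ : F[T;T⁻¹])}) :
    lop c s v ∈ Ideal.span {(LaurentPolynomial.T N - LaurentPolynomial.C γ : F[T;T⁻¹])} := by
  refine lstable _ _ (fun i => ?_) v hv
  refine Ideal.mem_span_singleton'.2 ⟨c i • LaurentPolynomial.T (i + s), ?_⟩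
  rw [mul_sub, mul_sub, ← LaurentPolynomial.T_add, mul_comm _ (LaurentPolynomial.C γ),
    mul_comm _ (LaurentPolynomial.C γ), ← LaurentPolynomial.smul_eq_C_mul,
    ← LaurentPolynomial.smul_eq_C_mul, map_sub, map_smul, lop_T, lop_T, hc, smul_mul_assoc,
    ← LaurentPolynomial.T_add]
  rw [show i + s + (N : ℤ) = i + N + s by ring]

/-- The linear map of `F[t]` with `t^i ↦ φ(i)`. -/
def pop (φ : ℕ → F[X]) : Module.End F F[X] := (Polynomial.basisMonomials F).constr F φ

theorem pop_X (φ : ℕ → F[X]) (i : ℕ) : pop φ (X ^ i) = φ i := by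
  have := (Polynomial.basisMonomials F).constr_basis F φ i
  rw [Polynomial.X_pow_eq_monomial]
  simpa only [Polynomial.coe_basisMonomials, pop] using this

theorem pend_ext {E E' : Module.End F F[X]} (h : ∀ i : ℕ, E (X ^ i) = E' (X ^ i)) : E = E' :=
  (Polynomial.basisMonomials F).ext fun i => by
    have := h i
    rw [Polynomial.X_pow_eq_monomial] at this
    simpa only [Polynomial.coe_basisMonomials] using this

/-- The ideal generated by `t^n` is stable under `t^i ↦ φ(i)` if it contains `φ(i)` for all
`i ≥ n`. -/
theorem pop_stable (φ : ℕ → F[X]) (n : ℕ) (h : ∀ i, φ (i + n) ∈ Ideal.span {(X ^ n : F[X])})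
    (v : F[X]) (hv : v ∈ Ideal.span {(X ^ n : F[X])}) :
    pop φ v ∈ Ideal.span {(X ^ n : F[X])} := by
  obtain ⟨a, rfl⟩ := Ideal.mem_span_singleton'.1 hv
  clear hv
  induction a using Polynomial.induction_on' with
  | add a b ha hb => rw [add_mul, map_add]; exact Ideal.add_mem _ ha hb
  | monomial i c =>
    rw [← Polynomial.C_mul_X_pow_eq_monomial, mul_assoc, ← pow_add, ← Polynomial.smul_eq_C_mul,
      map_smul, Polynomial.smul_eq_C_mul, pop_X]
    exact Ideal.mul_mem_left _ _ (h i)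

end Operators

/-! ### The modules `A(λ,μ)` -/

section ModA

variable {F : Type u} [Field F] {q : F} {f g : F[X]}

/-- `h t^i = λ(i) t^i`, `x t^i = t^(i+1)`, `y t^i = μ(i) t^(i-1)`. -/
def repA (lam : SF f) (mu : TF q g lam) : Alg q f g →ₐ[F] Module.End F F[T;T⁻¹] :=
  rep q f g (lop (fun _ => 1) 1) (lop mu (-1)) (lop lam 0)
    (lend_ext fun i => by
      have e := aeval_apply_of_eigen (lop (lam : ℤ → F) 0) (LaurentPolynomial.T i) (lam.1 i)
        (by rw [lop_T, add_zero]) f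
      rw [Module.End.mul_apply, Module.End.mul_apply, e, lop_T, map_smul, map_smul, lop_T, lop_T,
        lam.2 i, add_zero, one_smul, one_smul])
    (lend_ext fun i => by
      have e := aeval_apply_of_eigen (lop (lam : ℤ → F) 0) (LaurentPolynomial.T (i + -1))
        (lam.1 (i + -1)) (by rw [lop_T, add_zero]) f
      rw [Module.End.mul_apply, Module.End.mul_apply, lop_T, lop_T, map_smul, map_smul, e,
        lam.2, add_zero, lop_T, neg_add_cancel_right, smul_comm])
    (lend_ext fun i => by
      have e := aeval_apply_of_eigen (lop (lam : ℤ → F) 0) (LaurentPolynomial.T i) (lam.1 i)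
        (by rw [lop_T, add_zero]) g
      rw [LinearMap.sub_apply, LinearMap.smul_apply, Module.End.mul_apply, Module.End.mul_apply, e,
        lop_T, lop_T, map_smul, map_smul, lop_T, lop_T, mu.2 i, neg_add_cancel_right,
        add_neg_cancel_right, one_smul, one_smul, smul_smul, add_smul, add_sub_cancel_left])

/-- The underlying space `F[t, t⁻¹]` of `A(λ,μ)`. -/
def ModA (lam : SF f) (_mu : TF q g lam) : Type u := F[T;T⁻¹]

variable (lam : SF f) (mu : TF q g lam)

instance : AddCommGroup (ModA lam mu) := inferInstanceAs (AddCommGroup F[T;T⁻¹])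

instance : Module F (ModA lam mu) := inferInstanceAs (Module F F[T;T⁻¹])

instance : Module (Alg q f g) (ModA lam mu) :=
  Module.compHom F[T;T⁻¹] (repA lam mu).toRingHom

theorem smul_defA (a : Alg q f g) (v : ModA lam mu) : a • v = repA lam mu a v := rfl

instance : IsScalarTower F (Alg q f g) (ModA lam mu) where
  smul_assoc c a v := by
    rw [smul_defA, smul_defA, map_smul]
    rfl

/-- The element `t^i` of `A(λ,μ)`. -/
def monA (i : ℤ) : ModA lam mu := (LaurentPolynomial.T i : F[T;T⁻¹])

theorem h_monA (i : ℤ) : gen q f g Gen.h • monA lam mu i = lam.1 i • monA lam mu i := by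
  rw [smul_defA, repA, rep_gen]
  exact (lop_T _ _ _).trans (by rw [add_zero]; rfl)

theorem x_monA (i : ℤ) : gen q f g Gen.x • monA lam mu i = monA lam mu (i + 1) := by
  rw [smul_defA, repA, rep_gen]
  exact (lop_T _ _ _).trans (one_smul _ _)

theorem y_monA (i : ℤ) : gen q f g Gen.y • monA lam mu i = mu.1 i • monA lam mu (i - 1) := by
  rw [smul_defA, repA, rep_gen]
  exact (lop_T _ _ _).trans (rfl)

/-- The submodule `F[t, t⁻¹](t^(|λ||μ|) - γ)` of `A(λ,μ)`. -/
def subA (γ : F) : Submodule (Alg q f g) (ModA lam mu) where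
  carrier := {v : F[T;T⁻¹] | v ∈ Ideal.span
    {(LaurentPolynomial.T (per lam.1 mu.1 : ℤ) - LaurentPolynomial.C γ : F[T;T⁻¹])}}
  zero_mem' := (Ideal.span
    {(LaurentPolynomial.T (per lam.1 mu.1 : ℤ) - LaurentPolynomial.C γ : F[T;T⁻¹])}).zero_mem
  add_mem' := (Ideal.span
    {(LaurentPolynomial.T (per lam.1 mu.1 : ℤ) - LaurentPolynomial.C γ : F[T;T⁻¹])}).add_mem
  smul_mem' a v hv := stable_of_gen (repA lam mu)
    ((Ideal.span {(LaurentPolynomial.T (per lam.1 mu.1 : ℤ) - LaurentPolynomial.C γ :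
      F[T;T⁻¹])}).restrictScalars F)
    (fun b w hw => by
      rw [repA, rep_gen]
      cases b with
      | x => exact lop_stable _ _ _ (fun _ => rfl) γ w hw
      | y => exact lop_stable _ _ _ (mu_add_per mu.2) γ w hw
      | h => exact lop_stable _ _ _ (lam_add_per lam.1 mu.1) γ w hw) a v hv

/-- The quotient `A(λ,μ) / F[t, t⁻¹](t^(|λ||μ|) - γ)`. -/
abbrev QuoA (γ : F) : Type u := ModA lam mu ⧸ subA lam mu γ

end ModA

/-! ### The modules `B(λ,μ)` -/

section ModB

variable {F : Type u} [Field F] {q : F} {f g : F[X]}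

/-- `h t^i = λ(i) t^i`, `x t^i = μ(i+1) t^(i+1)`, `y t^i = t^(i-1)`. -/
def repB (lam : SF f) (mu : TF q g lam) : Alg q f g →ₐ[F] Module.End F F[T;T⁻¹] :=
  rep q f g (lop (fun i => mu.1 (i + 1)) 1) (lop (fun _ => 1) (-1)) (lop lam 0)
    (lend_ext fun i => by
      have e := aeval_apply_of_eigen (lop (lam : ℤ → F) 0) (LaurentPolynomial.T i) (lam.1 i)
        (by rw [lop_T, add_zero]) f
      rw [Module.End.mul_apply, Module.End.mul_apply, e, lop_T, map_smul, map_smul, lop_T, lop_T,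
        lam.2 i, add_zero, smul_comm])
    (lend_ext fun i => by
      have e := aeval_apply_of_eigen (lop (lam : ℤ → F) 0) (LaurentPolynomial.T (i + -1))
        (lam.1 (i + -1)) (by rw [lop_T, add_zero]) f
      rw [Module.End.mul_apply, Module.End.mul_apply, lop_T, lop_T, map_smul, map_smul, e,
        lam.2, add_zero, lop_T, neg_add_cancel_right, smul_comm])
    (lend_ext fun i => by
      have e := aeval_apply_of_eigen (lop (lam : ℤ → F) 0) (LaurentPolynomial.T i) (lam.1 i)
        (by rw [lop_T, add_zero]) g
      rw [LinearMap.sub_apply, LinearMap.smul_apply, Module.End.mul_apply, Module.End.mul_apply, e,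
        lop_T, lop_T, map_smul, map_smul, lop_T, lop_T, mu.2 i, neg_add_cancel_right,
        add_neg_cancel_right, one_smul, one_smul, smul_smul, add_smul, add_sub_cancel_left])

/-- The underlying space `F[t, t⁻¹]` of `B(λ,μ)`. -/
def ModB (lam : SF f) (_mu : TF q g lam) : Type u := F[T;T⁻¹]

variable (lam : SF f) (mu : TF q g lam)

instance : AddCommGroup (ModB lam mu) := inferInstanceAs (AddCommGroup F[T;T⁻¹])

instance : Module F (ModB lam mu) := inferInstanceAs (Module F F[T;T⁻¹])

instance : Module (Alg q f g) (ModB lam mu) :=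
  Module.compHom F[T;T⁻¹] (repB lam mu).toRingHom

theorem smul_defB (a : Alg q f g) (v : ModB lam mu) : a • v = repB lam mu a v := rfl

instance : IsScalarTower F (Alg q f g) (ModB lam mu) where
  smul_assoc c a v := by
    rw [smul_defB, smul_defB, map_smul]
    rfl

/-- The element `t^i` of `B(λ,μ)`. -/
def monB (i : ℤ) : ModB lam mu := (LaurentPolynomial.T i : F[T;T⁻¹])

theorem h_monB (i : ℤ) : gen q f g Gen.h • monB lam mu i = lam.1 i • monB lam mu i := by
  rw [smul_defB, repB, rep_gen]
  exact (lop_T _ _ _).trans (by rw [add_zero]; rfl)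

theorem x_monB (i : ℤ) : gen q f g Gen.x • monB lam mu i = mu.1 (i + 1) • monB lam mu (i + 1) := by
  rw [smul_defB, repB, rep_gen]
  exact (lop_T _ _ _).trans (rfl)

theorem y_monB (i : ℤ) : gen q f g Gen.y • monB lam mu i = monB lam mu (i - 1) := by
  rw [smul_defB, repB, rep_gen]
  exact (lop_T _ _ _).trans (one_smul _ _)

/-- The submodule `F[t, t⁻¹](t^(|λ||μ|) - γ)` of `B(λ,μ)`. -/
def subB (γ : F) : Submodule (Alg q f g) (ModB lam mu) where
  carrier := {v : F[T;T⁻¹] | v ∈ Ideal.span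
    {(LaurentPolynomial.T (per lam.1 mu.1 : ℤ) - LaurentPolynomial.C γ : F[T;T⁻¹])}}
  zero_mem' := (Ideal.span
    {(LaurentPolynomial.T (per lam.1 mu.1 : ℤ) - LaurentPolynomial.C γ : F[T;T⁻¹])}).zero_mem
  add_mem' := (Ideal.span
    {(LaurentPolynomial.T (per lam.1 mu.1 : ℤ) - LaurentPolynomial.C γ : F[T;T⁻¹])}).add_mem
  smul_mem' a v hv := stable_of_gen (repB lam mu)
    ((Ideal.span {(LaurentPolynomial.T (per lam.1 mu.1 : ℤ) - LaurentPolynomial.C γ :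
      F[T;T⁻¹])}).restrictScalars F)
    (fun b w hw => by
      rw [repB, rep_gen]
      cases b with
      | x => exact lop_stable _ _ _ (fun i => by rw [add_right_comm, mu_add_per mu.2]) γ w hw
      | y => exact lop_stable _ _ _ (fun _ => rfl) γ w hw
      | h => exact lop_stable _ _ _ (lam_add_per lam.1 mu.1) γ w hw) a v hv

/-- The quotient `B(λ,μ) / F[t, t⁻¹](t^(|λ||μ|) - γ)`. -/
abbrev QuoB (γ : F) : Type u := ModB lam mu ⧸ subB lam mu γ

end ModB

/-! ### The modules `C_α` -/

section ModC

variable {F : Type u} [Field F]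

/-- `f^(i)(α)`, the `i`-th iterate of `f` at `α`. -/
def iter (f : F[X]) (α : F) (i : ℕ) : F := (fun a => f.eval a)^[i] α

theorem iter_succ (f : F[X]) (α : F) (i : ℕ) : iter f α (i + 1) = f.eval (iter f α i) :=
  Function.iterate_succ_apply' _ _ _

/-- `ν_α(0) = 0` and `ν_α(i+1) = q ν_α(i) + g(f^(i)(α))`. -/
def nu (q : F) (f g : F[X]) (α : F) : ℕ → F
  | 0 => 0
  | i + 1 => q * nu q f g α i + g.eval (iter f α i)

/-- `h t^i = f^(i)(α) t^i`, `x t^i = t^(i+1)`, `y t^i = ν_α(i) t^(i-1)`, `y 1 = 0`. -/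
def repC (q : F) (f g : F[X]) (α : F) : Alg q f g →ₐ[F] Module.End F F[X] :=
  rep q f g (pop fun i => X ^ (i + 1)) (pop fun i => nu q f g α i • X ^ (i - 1))
    (pop fun i => iter f α i • X ^ i)
    (pend_ext fun i => by
      have e := aeval_apply_of_eigen (pop fun i => iter f α i • X ^ i) (X ^ i) (iter f α i)
        (pop_X _ i) f
      rw [Module.End.mul_apply, Module.End.mul_apply, e, map_smul, pop_X, pop_X, iter_succ])
    (pend_ext fun i => by
      rw [Module.End.mul_apply, Module.End.mul_apply, pop_X, pop_X, map_smul, map_smul, pop_X]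
      cases i with
      | zero => simp [nu]
      | succ i =>
        have e := aeval_apply_of_eigen (pop fun i => iter f α i • X ^ i) (X ^ i) (iter f α i)
          (pop_X _ i) f
        rw [Nat.add_sub_cancel, e, iter_succ, smul_comm])
    (pend_ext fun i => by
      have e := aeval_apply_of_eigen (pop fun i => iter f α i • X ^ i) (X ^ i) (iter f α i)
        (pop_X _ i) g
      rw [LinearMap.sub_apply, LinearMap.smul_apply, Module.End.mul_apply, Module.End.mul_apply, e,
        pop_X, pop_X, pop_X, map_smul, pop_X, Nat.add_sub_cancel]
      cases i with
      | zero => simp [nu]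
      | succ i =>
        rw [Nat.add_sub_cancel, smul_smul, ← sub_smul, nu.eq_2 q f g α (i + 1),
          add_sub_cancel_left])

/-- The underlying space `F[t]` of `C_α`. -/
def ModC (_q : F) (_f _g : F[X]) (_α : F) : Type u := F[X]

variable (q : F) (f g : F[X]) (α : F)

instance : AddCommGroup (ModC q f g α) := inferInstanceAs (AddCommGroup F[X])

instance : Module F (ModC q f g α) := inferInstanceAs (Module F F[X])

instance : Module (Alg q f g) (ModC q f g α) := Module.compHom F[X] (repC q f g α).toRingHom

theorem smul_defC (a : Alg q f g) (v : ModC q f g α) : a • v = repC q f g α a v := rfl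

instance : IsScalarTower F (Alg q f g) (ModC q f g α) where
  smul_assoc c a v := by
    rw [smul_defC, smul_defC, map_smul]
    rfl

/-- The element `t^i` of `C_α`. -/
def monC (i : ℕ) : ModC q f g α := (X ^ i : F[X])

theorem h_monC (i : ℕ) : gen q f g Gen.h • monC q f g α i = iter f α i • monC q f g α i := by
  rw [smul_defC, repC, rep_gen]
  exact pop_X _ _

theorem x_monC (i : ℕ) : gen q f g Gen.x • monC q f g α i = monC q f g α (i + 1) := by
  rw [smul_defC, repC, rep_gen]
  exact pop_X _ _

theorem y_monC_zero : gen q f g Gen.y • monC q f g α 0 = 0 := by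
  rw [smul_defC, repC, rep_gen]
  exact (pop_X _ _).trans (zero_smul _ _)

theorem y_monC_succ (i : ℕ) :
    gen q f g Gen.y • monC q f g α (i + 1) = nu q f g α (i + 1) • monC q f g α i := by
  rw [smul_defC, repC, rep_gen]
  exact pop_X _ _

variable {q f g α}

/-- The submodule `F[t] t^n` of `C_α`, for `ν_α(n) = 0`. -/
def subC {n : ℕ} (hn : nu q f g α n = 0) : Submodule (Alg q f g) (ModC q f g α) where
  carrier := {v : F[X] | v ∈ Ideal.span {(X ^ n : F[X])}}
  zero_mem' := (Ideal.span {(X ^ n : F[X])}).zero_mem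
  add_mem' := (Ideal.span {(X ^ n : F[X])}).add_mem
  smul_mem' a v hv := stable_of_gen (repC q f g α)
    ((Ideal.span {(X ^ n : F[X])}).restrictScalars F)
    (fun b w hw => by
      rw [repC, rep_gen]
      cases b with
      | x =>
        refine pop_stable _ n (fun i => ?_) w hw
        exact Ideal.mem_span_singleton.2 (pow_dvd_pow _ (by omega))
      | y =>
        refine pop_stable _ n (fun i => ?_) w hw
        cases i with
        | zero => simp [hn]
        | succ i =>
          rw [Polynomial.smul_eq_C_mul]
          exact Ideal.mul_mem_left _ _ (Ideal.mem_span_singleton.2 (pow_dvd_pow _ (by omega)))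
      | h =>
        refine pop_stable _ n (fun i => ?_) w hw
        rw [Polynomial.smul_eq_C_mul]
        exact Ideal.mul_mem_left _ _ (Ideal.mem_span_singleton.2 (pow_dvd_pow _ (by omega)))) a v hv

/-- The quotient `C_α / F[t] t^n`. -/
abbrev QuoC {n : ℕ} (hn : nu q f g α n = 0) : Type u := ModC q f g α ⧸ subC hn

end ModC

end

end QGHA

set_option linter.unusedSectionVars false

namespace QGHA

/-! ### Relations and submodules in a general module -/

section Relations

variable {F : Type u} [Field F] {q : F} {f g : F[X]}

/-! The three lists are told apart by the injectivity of two operators: `x` is injective on the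
modules in (a), `y` but not `x` on those in (b), neither on those in (c). For a simple module it
remains to produce, in each case, a spanning family on which the generators act as in the list.

Since `h x y = x f(h) y = x y h`, the operators `h` and `xy` commute and have joint eigenvectors. By
the relations, `x` sends the weight space of `(a, b)` into that of `(f(a), q b + g(a))`, the image
under `weightMap`; if `y` is invertible, so does its inverse. A finite-dimensional module has
finitely many weights, so for an invertible shift `S` of this kind some weight is periodic. If `N`
is its minimal period, `S ^ N` preserves its weight space and has an eigenvector `w` there, with
eigenvalue `γ`. The vectors `S ^ i w` span by simplicity, and their weights are distinct within a
period. This is a `WeightCycle`, constructed in `exists_weightCycle`.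

Elements built from `h` and `xy` project a cycle onto its lines (`exists_projection`). Hence one
period is a basis, every nonzero submodule contains a member, and isomorphisms match weights, so
that the two weight sequences differ by a shift (`eq_of_eq_at`). The scalar `γ` is read off from `x
^ N` or `y ^ N`. The quotients of `A(λ,μ)` and `B(λ,μ)` carry such cycles, and a cycle shifted by
`x` or by `y` is determined by its parameters.

If neither operator is injective, `x` is nilpotent (`x_nilpotent`). Applying `x` repeatedly to an
eigenvector of `h` in the kernel of `y` gives a finite chain (`NilChain`). Simplicity forces the
scalars `ν` to be nonzero before the end of the chain, and `α` is the eigenvalue of `h` on the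
kernel of `y`, which is a line. -/

theorem gen_h_mul_gen_x :
    gen q f g Gen.h * gen q f g Gen.x = gen q f g Gen.x * aeval (gen q f g Gen.h) f := by
  have := RingQuot.mkAlgHom_rel F (Rel.hx (q := q) (f := f) (g := g))
  change proj q f g _ = proj q f g _ at this
  rwa [map_mul, map_mul, ← Polynomial.aeval_algHom_apply] at this

theorem gen_y_mul_gen_h :
    gen q f g Gen.y * gen q f g Gen.h = aeval (gen q f g Gen.h) f * gen q f g Gen.y := by
  have := RingQuot.mkAlgHom_rel F (Rel.yh (q := q) (f := f) (g := g))
  change proj q f g _ = proj q f g _ at this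
  rwa [map_mul, map_mul, ← Polynomial.aeval_algHom_apply] at this

theorem gen_y_mul_gen_x :
    gen q f g Gen.y * gen q f g Gen.x =
      q • (gen q f g Gen.x * gen q f g Gen.y) + aeval (gen q f g Gen.h) g := by
  have := RingQuot.mkAlgHom_rel F (Rel.yx (q := q) (f := f) (g := g))
  change proj q f g _ = proj q f g _ at this
  rw [map_sub, map_smul, map_mul, map_mul, ← Polynomial.aeval_algHom_apply] at this
  exact sub_eq_iff_eq_add'.1 this

theorem simple_of_generator {M : Type*} [AddCommGroup M] [Module (Alg q f g) M] {v : M} (h0 : v ≠ 0)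
    (h : ∀ K : Submodule (Alg q f g) M, K ≠ ⊥ → v ∈ K)
    (ht : ∀ K : Submodule (Alg q f g) M, v ∈ K → K = ⊤) : IsSimpleModule (Alg q f g) M :=
  (isSimpleModule_iff _ _).2
    { exists_pair_ne := ⟨⊥, ⊤, fun e => h0 ((Submodule.mem_bot (Alg q f g)).1
        (e ▸ Submodule.mem_top))⟩
      eq_bot_or_eq_top := fun K => or_iff_not_imp_left.2 fun hK => ht K (h K hK) }

variable {M : Type*} [AddCommGroup M] [Module F M] [Module (Alg q f g) M]
  [IsScalarTower F (Alg q f g) M]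

variable (M) in
/-- The action of a generator as an `F`-linear map. -/
noncomputable def genEnd (q : F) (f g : F[X]) [Module (Alg q f g) M]
    [IsScalarTower F (Alg q f g) M] (a : Gen) : Module.End F M :=
  Algebra.lsmul F F M (gen q f g a)

@[simp]
theorem genEnd_apply (a : Gen) (v : M) : genEnd M q f g a v = gen q f g a • v := rfl

theorem aeval_gen_smul {v : M} {c : F} (hv : gen q f g Gen.h • v = c • v) (p : F[X]) :
    aeval (gen q f g Gen.h) p • v = p.eval c • v := by
  have := aeval_apply_of_eigen (genEnd M q f g Gen.h) v c hv p
  rwa [genEnd, Polynomial.aeval_algHom_apply] at this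

theorem h_x_smul {v : M} {c : F} (hv : gen q f g Gen.h • v = c • v) :
    gen q f g Gen.h • gen q f g Gen.x • v = f.eval c • gen q f g Gen.x • v := by
  rw [← mul_smul, gen_h_mul_gen_x, mul_smul, aeval_gen_smul hv, smul_comm]

/-- The relation `y x = q x y + g(h)` evaluated on a weight vector. It gives the second component of
`weightMap`, and it determines `y` wherever `x` is known. -/
theorem y_x_smul {v : M} {a b : F} (ha : gen q f g Gen.h • v = a • v)
    (hb : gen q f g Gen.x • gen q f g Gen.y • v = b • v) :
    gen q f g Gen.y • gen q f g Gen.x • v = (q * b + g.eval a) • v := by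
  rw [← mul_smul, gen_y_mul_gen_x, add_smul, smul_assoc, mul_smul, hb, aeval_gen_smul ha,
    smul_smul, add_smul]

/-- Moving `h` past `x` turns it into `f(h)`, and moving that past `y` turns it back into `h`. -/
theorem h_commute_xy : Commute (gen q f g Gen.h) (gen q f g Gen.x * gen q f g Gen.y) := by
  rw [Commute, SemiconjBy, ← mul_assoc, gen_h_mul_gen_x, mul_assoc, ← gen_y_mul_gen_h, mul_assoc]

variable (q f g) in
/-- An `F`-subspace stable under the generators, as a submodule. -/
def submoduleOfStable (K : Submodule F M) (hK : ∀ a, ∀ v ∈ K, gen q f g a • v ∈ K) :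
    Submodule (Alg q f g) M where
  carrier := K
  zero_mem' := K.zero_mem
  add_mem' := K.add_mem
  smul_mem' a v hv := stable_of_gen (Algebra.lsmul F F M) K hK a v hv

variable (q f g) in
/-- In a simple module a stable subspace with a nonzero vector is everything. -/
theorem eq_top_of_stable [IsSimpleModule (Alg q f g) M] (K : Submodule F M)
    (hK : ∀ a, ∀ v ∈ K, gen q f g a • v ∈ K) {v : M} (hv : v ∈ K) (h0 : v ≠ 0) : K = ⊤ := by
  rcases eq_bot_or_eq_top (submoduleOfStable q f g K hK) with h | h
  · have : v ∈ submoduleOfStable q f g K hK := hv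
    rw [h] at this
    exact absurd ((Submodule.mem_bot _).1 this) h0
  · refine eq_top_iff.2 fun w _ => ?_
    have : w ∈ submoduleOfStable q f g K hK := h ▸ Submodule.mem_top
    exact this

variable (q f g) in
-- A family that the generators permute up to scalars spans a stable subspace. All spanning
-- statements for cycles and chains in simple modules come from here.
theorem span_range_eq_top [IsSimpleModule (Alg q f g) M] {ι : Type*} (e : ι → M)
    (he : ∀ a i, ∃ c : F, ∃ j, gen q f g a • e i = c • e j) {i : ι} (h0 : e i ≠ 0) :
    Submodule.span F (Set.range e) = ⊤ := by
  refine eq_top_of_stable q f g _ (fun a v hv => ?_) (Submodule.subset_span ⟨i, rfl⟩) h0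
  have : Submodule.span F (Set.range e) ≤
      (Submodule.span F (Set.range e)).comap (genEnd M q f g a) := by
    refine Submodule.span_le.2 ?_
    rintro _ ⟨i, rfl⟩
    obtain ⟨c, j, h⟩ := he a i
    change gen q f g a • e i ∈ Submodule.span F (Set.range e)
    rw [h]
    exact Submodule.smul_mem _ _ (Submodule.subset_span ⟨j, rfl⟩)
  exact this hv

theorem span_range_mk_eq_top (K : Submodule (Alg q f g) M) {ι : Type*} {e : ι → M}
    (he : Submodule.span F (Set.range e) = ⊤) :
    Submodule.span F (Set.range fun i => (Submodule.Quotient.mk (e i) : M ⧸ K)) = ⊤ := by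
  have h := congrArg (Submodule.map (K.mkQ.restrictScalars F)) he
  rw [Submodule.map_span, ← Set.range_comp, Submodule.map_top] at h
  exact h.trans (LinearMap.range_eq_top.2 (Submodule.mkQ_surjective _))

variable {M' : Type*} [AddCommGroup M'] [Module F M'] [Module (Alg q f g) M']
  [IsScalarTower F (Alg q f g) M']

theorem map_gen_smul_of_span {ι : Type*} {e : ι → M} (he : Submodule.span F (Set.range e) = ⊤)
    (φ : M →ₗ[F] M') (a : Gen) (h : ∀ i, φ (gen q f g a • e i) = gen q f g a • φ (e i)) (v : M) :
    φ (gen q f g a • v) = gen q f g a • φ v := by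
  have : φ ∘ₗ genEnd M q f g a = genEnd M' q f g a ∘ₗ φ := by
    refine LinearMap.ext_on_range he fun i => ?_
    simpa using h i
  exact LinearMap.congr_fun this v

variable (q f g) in
/-- An `F`-linear equivalence that commutes with the generators is an isomorphism of modules. -/
def equivOfGen (φ : M ≃ₗ[F] M')
    (h : ∀ a v, φ (gen q f g a • v) = gen q f g a • φ v) : M ≃ₗ[Alg q f g] M' where
  toFun := φ
  invFun := φ.symm
  left_inv := φ.left_inv
  right_inv := φ.right_inv
  map_add' := map_add φ
  map_smul' c v := by
    -- Linearity over the whole algebra says that the graph of `φ` is a submodule of `M × M'`, and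
    -- stability of the graph need only be checked on generators.
    have := stable_of_gen (q := q) (f := f) (g := g) (V := M × M')
      (Algebra.lsmul F F (M × M')) (LinearMap.graph φ.toLinearMap)
      (by
        rintro a ⟨v, w⟩ hv
        rw [LinearMap.mem_graph_iff] at hv ⊢
        change w = φ v at hv
        change gen q f g a • w = φ (gen q f g a • v)
        rw [h, hv]) c (v, φ v) (by rw [LinearMap.mem_graph_iff]; rfl)
    rw [LinearMap.mem_graph_iff] at this
    exact this.symm

theorem equiv_smul_F (φ : M ≃ₗ[Alg q f g] M') (c : F) (v : M) : φ (c • v) = c • φ v := by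
  rw [← algebraMap_smul (Alg q f g) c v, map_smul, algebraMap_smul]

end Relations

/-! ### Eigenvectors in stable subspaces -/

section Eigen

variable {F : Type u} [Field F] [IsAlgClosed F] {V : Type*} [AddCommGroup V] [Module F V]
  [FiniteDimensional F V]

theorem exists_eigenvector_mem (W : Submodule F V) (hW : W ≠ ⊥) (E : Module.End F V)
    (hE : ∀ w ∈ W, E w ∈ W) : ∃ w ∈ W, w ≠ 0 ∧ ∃ c : F, E w = c • w := by
  have : Nontrivial W := Submodule.nontrivial_iff_ne_bot.2 hW
  obtain ⟨c, hc⟩ := Module.End.exists_eigenvalue (E.restrict hE)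
  obtain ⟨w, hw⟩ := hc.exists_hasEigenvector
  refine ⟨w, w.2, fun h => hw.2 (Subtype.ext h), c, ?_⟩
  have := congrArg Subtype.val hw.apply_eq_smul
  simpa using this

/-- An eigenspace of `E` inside `W` is preserved by the commuting operator `E'`, which therefore has
an eigenvector in it. -/
theorem exists_joint_eigenvector_mem (W : Submodule F V) (hW : W ≠ ⊥) (E E' : Module.End F V)
    (hE : ∀ w ∈ W, E w ∈ W) (hE' : ∀ w ∈ W, E' w ∈ W) (hc : Commute E E') :
    ∃ w ∈ W, w ≠ 0 ∧ (∃ c : F, E w = c • w) ∧ ∃ c : F, E' w = c • w := by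
  obtain ⟨w, hw, h0, a, ha⟩ := exists_eigenvector_mem W hW E hE
  obtain ⟨w', hw', h0', b, hb⟩ := exists_eigenvector_mem (W ⊓ E.eigenspace a)
    (fun h => h0 ((Submodule.mem_bot F).1 (h ▸ ⟨hw, Module.End.mem_eigenspace_iff.2 ha⟩))) E'
    (fun w hw => ⟨hE' w hw.1, by
      have h1 := Module.End.mem_eigenspace_iff.1 hw.2
      refine Module.End.mem_eigenspace_iff.2 ?_
      rw [← Module.End.mul_apply, hc.eq, Module.End.mul_apply, h1,
        map_smul]⟩)
  exact ⟨w', hw'.1, h0', ⟨a, Module.End.mem_eigenspace_iff.1 hw'.2⟩, b, hb⟩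

end Eigen

/-! ### Cyclic families of weight vectors -/

section Cycle

variable {F : Type u} [Field F] {q : F} {f g : F[X]}
variable {M : Type*} [AddCommGroup M] [Module F M] [Module (Alg q f g) M]

variable (q f g) in
/-- A spanning family of joint eigenvectors of `h` and `xy` that is periodic up to the factor `γ`,
with joint eigenvalues that are distinct within a period `N`. -/
structure WeightCycle (N : ℕ) (lam mu : ℤ → F) (γ : F) (e : ℤ → M) : Prop where
  pos : 0 < N
  ne_zero : ∀ i, e i ≠ 0
  add_period : ∀ i, e (i + N) = γ • e i
  h_smul : ∀ i, gen q f g Gen.h • e i = lam i • e i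
  xy_smul : ∀ i, gen q f g Gen.x • gen q f g Gen.y • e i = mu i • e i
  separated : ∀ i j, lam i = lam j → mu i = mu j → (N : ℤ) ∣ i - j
  span_eq_top : Submodule.span F (Set.range e) = ⊤

namespace WeightCycle

variable {N : ℕ} {lam mu : ℤ → F} {γ : F} {e : ℤ → M}

theorem gamma_ne_zero (he : WeightCycle q f g N lam mu γ e) : γ ≠ 0 := by
  rintro rfl
  exact he.ne_zero (0 + N) (by rw [he.add_period, zero_smul])

theorem add_mul_period (he : WeightCycle q f g N lam mu γ e) (i k : ℤ) :
    e (i + k * N) = γ ^ k • e i := by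
  have hγ := he.gamma_ne_zero
  induction k using Int.induction_on with
  | zero => simp
  | succ k ih =>
    rw [show i + ((k : ℤ) + 1) * N = i + k * N + N by ring, he.add_period, ih, smul_smul,
      zpow_add_one₀ hγ, mul_comm]
  | pred k ih =>
    have := he.add_period (i + (-(k : ℤ) - 1) * N)
    rw [show i + (-(k : ℤ) - 1) * N + N = i + -(k : ℤ) * N by ring, ih] at this
    rw [zpow_sub_one₀ hγ, mul_comm (γ ^ _), mul_smul, this, smul_smul, inv_mul_cancel₀ hγ, one_smul]

theorem exists_fin (he : WeightCycle q f g N lam mu γ e) (i : ℤ) :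
    ∃ (r : Fin N) (k : ℤ), i = (r : ℕ) + k * N := by
  have hN : (0 : ℤ) < N := by exact_mod_cast he.pos
  have h1 := Int.emod_nonneg i hN.ne'
  have h2 := Int.emod_lt_of_pos i hN
  refine ⟨⟨(i % N).toNat, by omega⟩, i / N, ?_⟩
  rw [Int.toNat_of_nonneg h1, mul_comm, Int.emod_add_mul_ediv]

theorem fin_ne (he : WeightCycle q f g N lam mu γ e) {i j : Fin N} (hij : i ≠ j) :
    lam (i : ℕ) ≠ lam (j : ℕ) ∨ mu (i : ℕ) ≠ mu (j : ℕ) := by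
  by_contra! h
  have h1 := he.separated _ _ h.1 h.2
  have h2 := Int.eq_zero_of_abs_lt_dvd h1 (by
    have := i.2
    have := j.2
    rw [abs_lt]
    constructor <;> omega)
  exact hij (Fin.ext (by omega))

theorem span_fin (he : WeightCycle q f g N lam mu γ e) :
    Submodule.span F (Set.range fun i : Fin N => e (i : ℕ)) = ⊤ := by
  rw [← top_le_iff, ← he.span_eq_top, Submodule.span_le]
  rintro _ ⟨i, rfl⟩
  obtain ⟨r, k, rfl⟩ := he.exists_fin i
  rw [he.add_mul_period]
  exact Submodule.smul_mem _ _ (Submodule.subset_span ⟨r, rfl⟩)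

theorem of_add_left (he : WeightCycle q f g N lam mu γ e) (j : ℤ) :
    WeightCycle q f g N (fun i => lam (i + j)) (fun i => mu (i + j)) γ fun i => e (i + j) where
  pos := he.pos
  ne_zero i := he.ne_zero _
  add_period i := by rw [add_right_comm, he.add_period]
  h_smul i := he.h_smul _
  xy_smul i := he.xy_smul _
  separated i i' h h' := by simpa using he.separated _ _ h h'
  span_eq_top := by
    rw [← he.span_eq_top]
    congr 1
    exact (Equiv.addRight j).surjective.range_comp e

variable [IsScalarTower F (Alg q f g) M]

/-- Lagrange interpolation in two commuting variables: `p` is a product of factors `t - w a` over `a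
∈ s`, where `t` is `h` or `xy`, whichever separates `i` from `a`. -/
theorem exists_annihilator (he : WeightCycle q f g N lam mu γ e) (i : Fin N) (s : Finset (Fin N))
    (hi : i ∉ s) : ∃ (p : Alg q f g) (c : Fin N → F),
      (∀ j : Fin N, p • e (j : ℕ) = c j • e (j : ℕ)) ∧ (∀ j ∈ s, c j = 0) ∧ c i ≠ 0 := by
  classical
  induction s using Finset.induction_on with
  | empty => exact ⟨1, 1, by simp, by simp, by simp⟩
  | insert a s ha ih =>
    rw [Finset.mem_insert, not_or] at hi
    obtain ⟨p, c, hp, h0, hc⟩ := ih hi.2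
    obtain ⟨t, w, ht, hw⟩ : ∃ (t : Alg q f g) (w : Fin N → F),
        (∀ j : Fin N, t • e (j : ℕ) = w j • e (j : ℕ)) ∧ w i ≠ w a := by
      rcases he.fin_ne hi.1 with h | h
      · exact ⟨_, fun j => lam (j : ℕ), fun j => he.h_smul _, h⟩
      · exact ⟨gen q f g Gen.x * gen q f g Gen.y, fun j => mu (j : ℕ),
          fun j => by rw [mul_smul]; exact he.xy_smul _, h⟩
    refine ⟨(t - algebraMap F _ (w a)) * p, fun j => c j * (w j - w a), fun j => ?_, fun j hj => ?_,
      mul_ne_zero hc (sub_ne_zero.2 hw)⟩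
    · rw [mul_smul, hp, smul_comm, sub_smul, algebraMap_smul, ht, ← sub_smul, smul_smul]
    · rcases Finset.mem_insert.1 hj with rfl | hj
      · simp
      · simp [h0 j hj]

/-- An element of the algebra that acts as the projection onto the line of `e i`. -/
theorem exists_projection (he : WeightCycle q f g N lam mu γ e) (i : Fin N) :
    ∃ p : Alg q f g, ∀ c : Fin N → F, p • ∑ j, c j • e (j : ℕ) = c i • e (i : ℕ) := by
  classical
  obtain ⟨p, c, hp, h0, hc⟩ := he.exists_annihilator i (Finset.univ.erase i) (by simp)
  refine ⟨algebraMap F _ (c i)⁻¹ * p, fun d => ?_⟩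
  rw [Finset.smul_sum, Finset.sum_eq_single i]
  · rw [mul_smul, smul_comm p, hp, algebraMap_smul, smul_smul, smul_smul]
    congr 1
    field_simp
  · intro j _ hj
    rw [mul_smul, smul_comm p, hp, h0 j (by simp [hj]), zero_smul, smul_zero, smul_zero]
  · simp

theorem linearIndependent (he : WeightCycle q f g N lam mu γ e) :
    LinearIndependent F fun i : Fin N => e (i : ℕ) := by
  rw [Fintype.linearIndependent_iff]
  intro c hc i
  obtain ⟨p, hp⟩ := he.exists_projection i
  have := hp c
  rw [hc, smul_zero] at this
  exact (smul_eq_zero.1 this.symm).resolve_right (he.ne_zero _)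

/-- The members of one period form a basis. -/
noncomputable def basis (he : WeightCycle q f g N lam mu γ e) : Module.Basis (Fin N) F M :=
  Module.Basis.mk he.linearIndependent he.span_fin.ge

theorem basis_apply (he : WeightCycle q f g N lam mu γ e) (i : Fin N) :
    he.basis i = e (i : ℕ) := by
  rw [basis, Module.Basis.mk_apply]

theorem finrank_eq (he : WeightCycle q f g N lam mu γ e) : Module.finrank F M = N := by
  rw [Module.finrank_eq_card_basis he.basis, Fintype.card_fin]

theorem sum_repr (he : WeightCycle q f g N lam mu γ e) (v : M) :
    ∑ i : Fin N, he.basis.repr v i • e (i : ℕ) = v := by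
  simpa only [he.basis_apply] using he.basis.sum_repr v

/-- Project a nonzero vector of `K` onto a line where its coordinate is nonzero. -/
theorem exists_mem (he : WeightCycle q f g N lam mu γ e) (K : Submodule (Alg q f g) M)
    (hK : K ≠ ⊥) : ∃ i, e i ∈ K := by
  obtain ⟨v, hv, h0⟩ := (Submodule.ne_bot_iff _).1 hK
  have hr : he.basis.repr v ≠ 0 := fun h => h0 (by simpa using h)
  obtain ⟨i, hi⟩ := Finsupp.ne_iff.1 hr
  obtain ⟨p, hp⟩ := he.exists_projection i
  have h1 := hp (he.basis.repr v)
  rw [he.sum_repr] at h1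
  have h2 : algebraMap F (Alg q f g) (he.basis.repr v i)⁻¹ • p • v ∈ K :=
    K.smul_mem _ (K.smul_mem _ hv)
  rw [h1, algebraMap_smul, smul_smul, inv_mul_cancel₀ hi, one_smul] at h2
  exact ⟨_, h2⟩

/-- A submodule that contains the whole family is everything. -/
theorem eq_top (he : WeightCycle q f g N lam mu γ e) (K : Submodule (Alg q f g) M)
    (h : ∀ i, e i ∈ K) : K = ⊤ := by
  refine eq_top_iff.2 fun v _ => ?_
  rw [← he.sum_repr v]
  refine Submodule.sum_mem _ fun i _ => ?_
  rw [← algebraMap_smul (Alg q f g)]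
  exact K.smul_mem _ (h _)

/-- A joint eigenvector of `h` and `xy` is a multiple of a member of the family. -/
theorem eq_smul_of_eigen (he : WeightCycle q f g N lam mu γ e) {v : M} (h0 : v ≠ 0) {a b : F}
    (ha : gen q f g Gen.h • v = a • v)
    (hb : gen q f g Gen.x • gen q f g Gen.y • v = b • v) :
    ∃ (c : F) (j : ℤ), c ≠ 0 ∧ v = c • e j ∧ lam j = a ∧ mu j = b := by
  -- An eigenvector of a diagonal operator is supported on the indices with its eigenvalue. For `h`
  -- and `xy` together, this leaves a single index in a period.
  have key : ∀ (T : Module.End F M) (w : ℤ → F) (a : F), (∀ i, T (e i) = w i • e i) →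
      T v = a • v → ∀ i, he.basis.repr v i ≠ 0 → w (i : ℕ) = a := by
    intro T w a hT hv i hi
    have h1 : ∑ i : Fin N, (he.basis.repr v i * (w (i : ℕ) - a)) • e (i : ℕ) = 0 := by
      have h2 : T v - a • v = 0 := sub_eq_zero.2 hv
      conv at h2 => lhs; rw [← he.sum_repr v]
      rw [map_sum, Finset.smul_sum, ← Finset.sum_sub_distrib] at h2
      rw [← h2]
      refine Finset.sum_congr rfl fun i _ => ?_
      rw [map_smul, hT, smul_smul, smul_smul, ← sub_smul]
      congr 1
      ring
    have h3 := Fintype.linearIndependent_iff.1 he.linearIndependent _ h1 i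
    exact sub_eq_zero.1 ((mul_eq_zero.1 h3).resolve_left hi)
  have hr : he.basis.repr v ≠ 0 := fun h => h0 (by simpa using h)
  obtain ⟨i, hi⟩ := Finsupp.ne_iff.1 hr
  have kh := key (genEnd M q f g Gen.h) lam a he.h_smul ha
  have kz := key (genEnd M q f g Gen.x * genEnd M q f g Gen.y) mu b he.xy_smul hb
  refine ⟨he.basis.repr v i, (i : ℕ), hi, ?_, kh i hi, kz i hi⟩
  conv_lhs => rw [← he.sum_repr v]
  refine Finset.sum_eq_single i (fun j _ hj => ?_) (by simp)
  by_cases hj0 : he.basis.repr v j = 0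
  · rw [hj0, zero_smul]
  · rcases he.fin_ne hj with h | h
    · exact absurd ((kh j hj0).trans (kh i hi).symm) h
    · exact absurd ((kz j hj0).trans (kz i hi).symm) h

variable {M' : Type*} [AddCommGroup M'] [Module F M'] [Module (Alg q f g) M']
  [IsScalarTower F (Alg q f g) M'] {e' : ℤ → M'}

/-- The bases given by one period are matched; the common factor `γ` extends the match to all
integer indices. -/
theorem exists_equiv (he : WeightCycle q f g N lam mu γ e)
    (he' : WeightCycle q f g N lam mu γ e') : ∃ φ : M ≃ₗ[F] M', ∀ i, φ (e i) = e' i := by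
  refine ⟨he.basis.equiv he'.basis (Equiv.refl _), fun i => ?_⟩
  obtain ⟨r, k, rfl⟩ := he.exists_fin i
  rw [he.add_mul_period, he'.add_mul_period, map_smul, ← he.basis_apply, Module.Basis.equiv_apply,
    he'.basis_apply, Equiv.refl_apply]

/-- The weights of isomorphic cyclic families agree up to a shift. -/
theorem shift_of_equiv (he : WeightCycle q f g N lam mu γ e) {lam' mu' : ℤ → F} {γ' : F}
    (he' : WeightCycle q f g N lam' mu' γ' e') (φ : M ≃ₗ[Alg q f g] M') :
    ∃ (c : F) (j : ℤ), c ≠ 0 ∧ φ (e 0) = c • e' j ∧ lam' j = lam 0 ∧ mu' j = mu 0 :=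
  he'.eq_smul_of_eigen (fun h => he.ne_zero 0 (φ.map_eq_zero_iff.1 h))
    (by rw [← map_smul, he.h_smul, equiv_smul_F])
    (by rw [← map_smul, ← map_smul, he.xy_smul, equiv_smul_F])

end WeightCycle

end Cycle

/-! ### Weight sequences -/

section Sequences

variable {F : Type u} [Field F] {q : F} {f g : F[X]}

/-- The recursions propagate agreement only forwards, as `f` need not be injective. The common
period `N` lets a backward step be replaced by a forward one. -/
theorem eq_of_eq_at {lam lam' mu mu' : ℤ → F} (hl : lam ∈ SF f) (hl' : lam' ∈ SF f)
    (hm : mu ∈ TF q g lam) (hm' : mu' ∈ TF q g lam') {N : ℕ} (hN : 0 < N)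
    (pl : ∀ i, lam (i + N) = lam i) (pl' : ∀ i, lam' (i + N) = lam' i)
    (pm : ∀ i, mu (i + N) = mu i) (pm' : ∀ i, mu' (i + N) = mu' i) {i j : ℤ}
    (h : lam i = lam' j) (h' : mu i = mu' j) (k : ℤ) :
    lam (i + k) = lam' (j + k) ∧ mu (i + k) = mu' (j + k) := by
  have nat : ∀ m : ℕ, lam (i + m) = lam' (j + m) ∧ mu (i + m) = mu' (j + m) := by
    intro m
    induction m with
    | zero => simpa using ⟨h, h'⟩
    | succ m ih =>
      rw [Nat.cast_succ, ← add_assoc, ← add_assoc, ← hl, ← hl', hm, hm', ih.1, ih.2]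
      exact ⟨rfl, rfl⟩
  have period : ∀ s : ℤ → F, (∀ i, s (i + N) = s i) → ∀ (i : ℤ) (m : ℕ), s (i + m * N) = s i := by
    intro s hs i m
    induction m with
    | zero => simp
    | succ m ih =>
      rw [show i + ((m + 1 : ℕ) : ℤ) * N = i + m * N + N by push_cast; ring, hs, ih]
  -- Adding `|k|` periods makes the step nonnegative because `N ≥ 1`.
  obtain ⟨m, hm⟩ : ∃ m : ℕ, (m : ℤ) = k + k.natAbs * N := by
    refine ⟨(k + k.natAbs * N).toNat, Int.toNat_of_nonneg ?_⟩
    have h1 : (k.natAbs : ℤ) ≤ k.natAbs * N := le_mul_of_one_le_right (by omega) (by omega)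
    omega
  have := nat m
  rw [hm, ← add_assoc, ← add_assoc, period _ pl, period _ pl', period _ pm, period _ pm'] at this
  exact this

theorem per_dvd {lam mu : ℤ → F} (hm : mu ∈ TF q g lam) {d : ℤ} (h : ∀ i, lam (i + d) = lam i)
    (h' : mu d = mu 0) : (per lam mu : ℤ) ∣ d := by
  obtain ⟨k, rfl⟩ := (lamPer_dvd_iff lam d).2 fun i => (h i).symm
  rw [per, Nat.cast_mul]
  refine mul_dvd_mul_left _ ((muPer_dvd_iff hm k).2 ?_)
  rw [mul_comm, h']

/-- Equal weights at `i` and `j` propagate to all indices, so `i - j` is a common period. This is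
the separation condition for the quotients of `A(λ,μ)` and `B(λ,μ)`. -/
theorem per_dvd_sub {lam mu : ℤ → F} (hl : lam ∈ SF f) (hm : mu ∈ TF q g lam)
    (hN : 0 < per lam mu) (i j : ℤ) (h : lam i = lam j) (h' : mu i = mu j) :
    (per lam mu : ℤ) ∣ i - j := by
  have key := eq_of_eq_at hl hl hm hm hN (lam_add_per lam mu) (lam_add_per lam mu)
    (mu_add_per hm) (mu_add_per hm) h h'
  refine per_dvd hm (fun k => ?_) ?_
  · have := (key (k - j)).1
    rwa [show i + (k - j) = k + (i - j) by ring, show j + (k - j) = k by ring] at this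
  · have := (key (-j)).2
    rwa [← sub_eq_add_neg, ← sub_eq_add_neg, sub_self] at this

theorem per_eq {lam mu : ℤ → F} (hm : mu ∈ TF q g lam) {N : ℕ}
    (hl : ∀ i, lam (i + N) = lam i) (h0 : mu N = mu 0)
    (hs : ∀ i j, lam i = lam j → mu i = mu j → (N : ℤ) ∣ i - j) : per lam mu = N := by
  refine Nat.dvd_antisymm (Int.natCast_dvd_natCast.1 (per_dvd hm hl h0))
    (Int.natCast_dvd_natCast.1 ?_)
  have h1 := lam_add_per lam mu 0
  have h2 := mu_add_per hm 0
  simpa using hs _ _ h1 h2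

end Sequences

/-! ### The two kinds of cyclic families -/

section Cycle

variable {F : Type u} [Field F] {q : F} {f g : F[X]}
variable {M : Type*} [AddCommGroup M] [Module F M] [Module (Alg q f g) M]
  [IsScalarTower F (Alg q f g) M]
variable {M' : Type*} [AddCommGroup M'] [Module F M'] [Module (Alg q f g) M']
  [IsScalarTower F (Alg q f g) M']

namespace WeightCycle

variable {N : ℕ} {lam mu : ℤ → F} {γ : F} {e : ℤ → M} {lam' mu' : ℤ → F} {γ' : F} {e' : ℤ → M'}

theorem lam_add (he : WeightCycle q f g N lam mu γ e) (i : ℤ) : lam (i + N) = lam i := by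
  have h := he.h_smul (i + N)
  rw [he.add_period, smul_comm, he.h_smul, smul_comm γ] at h
  exact (smul_left_injective F (smul_ne_zero he.gamma_ne_zero (he.ne_zero i))
    (by simpa only [smul_comm γ] using h)).symm

theorem mu_add (he : WeightCycle q f g N lam mu γ e) (i : ℤ) : mu (i + N) = mu i := by
  have h := he.xy_smul (i + N)
  rw [he.add_period, smul_comm (gen q f g Gen.y) γ, smul_comm (gen q f g Gen.x) γ,
    he.xy_smul] at h
  exact (smul_left_injective F (smul_ne_zero he.gamma_ne_zero (he.ne_zero i))
    (by simpa only [smul_comm γ] using h)).symm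

theorem mem_of_mem_add (he : WeightCycle q f g N lam mu γ e) {K : Submodule (Alg q f g) M}
    {i : ℤ} (k : ℤ) (h : e (i + k * N) ∈ K) : e i ∈ K := by
  have := K.smul_mem (algebraMap F _ (γ ^ k)⁻¹) h
  rwa [he.add_mul_period, algebraMap_smul, smul_smul,
    inv_mul_cancel₀ (zpow_ne_zero _ he.gamma_ne_zero), one_smul] at this

/-- Powers of `x` or `y` shift in one direction only; modulo whole periods this reaches every index.
-/
theorem exists_nat_eq (he : WeightCycle q f g N lam mu γ e) (k : ℤ) :
    ∃ m l : ℕ, (m : ℤ) = k + l * N := by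
  refine ⟨(k + k.natAbs * N).toNat, k.natAbs, Int.toNat_of_nonneg ?_⟩
  have h1 : (k.natAbs : ℤ) ≤ k.natAbs * N :=
    le_mul_of_one_le_right (by omega) (by exact_mod_cast he.pos)
  omega

theorem simple_of_mem (he : WeightCycle q f g N lam mu γ e)
    (h : ∀ (K : Submodule (Alg q f g) M) i, e i ∈ K → ∀ j, e j ∈ K) :
    IsSimpleModule (Alg q f g) M :=
  simple_of_generator (he.ne_zero 0)
    (fun K hK => let ⟨i, hi⟩ := he.exists_mem K hK; h K i hi 0)
    fun K hK => he.eq_top K (h K 0 hK)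

theorem surjective_of_mem_range (he : WeightCycle q f g N lam mu γ e) {a : Gen}
    (h : ∀ i, ∃ v, gen q f g a • v = e i) : Function.Surjective fun v : M => gen q f g a • v := by
  have : LinearMap.range (genEnd M q f g a) = ⊤ := by
    rw [← top_le_iff, ← he.span_eq_top, Submodule.span_le]
    rintro _ ⟨i, rfl⟩
    exact h i
  exact LinearMap.range_eq_top.1 this

theorem finiteDimensional (he : WeightCycle q f g N lam mu γ e) : FiniteDimensional F M :=
  Module.Finite.of_basis he.basis

theorem injective_of_mem_range (he : WeightCycle q f g N lam mu γ e) {a : Gen}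
    (h : ∀ i, ∃ v, gen q f g a • v = e i) : Function.Injective fun v : M => gen q f g a • v := by
  have := he.finiteDimensional
  exact (LinearMap.injective_iff_surjective (f := genEnd M q f g a)).2
    (he.surjective_of_mem_range h)

/-! ### Cycles shifted by `x` -/

section XShift

/-- As `e i = x e (i - 1)`, the action of `y` is that of `yx` on a weight vector. The weights and
`γ` thus determine the module. -/
theorem y_smul_of_x (he : WeightCycle q f g N lam mu γ e)
    (hx : ∀ i, gen q f g Gen.x • e i = e (i + 1)) (i : ℤ) :
    gen q f g Gen.y • e i = (q * mu (i - 1) + g.eval (lam (i - 1))) • e (i - 1) := by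
  rw [← y_x_smul (he.h_smul (i - 1)) (he.xy_smul (i - 1)), hx, sub_add_cancel]

theorem x_pow_smul (hx : ∀ i, gen q f g Gen.x • e i = e (i + 1)) (m : ℕ) (i : ℤ) :
    gen q f g Gen.x ^ m • e i = e (i + m) := by
  induction m with
  | zero => simp
  | succ m ih => rw [pow_succ', mul_smul, ih, hx, Nat.cast_succ, add_assoc]

theorem simple_of_x (he : WeightCycle q f g N lam mu γ e)
    (hx : ∀ i, gen q f g Gen.x • e i = e (i + 1)) : IsSimpleModule (Alg q f g) M := by
  refine he.simple_of_mem fun K i hi j => ?_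
  obtain ⟨m, l, hm⟩ := he.exists_nat_eq (j - i)
  have := K.smul_mem (gen q f g Gen.x ^ m) hi
  rw [x_pow_smul hx, hm, ← add_assoc, add_sub_cancel] at this
  exact he.mem_of_mem_add _ this

theorem x_injective (he : WeightCycle q f g N lam mu γ e)
    (hx : ∀ i, gen q f g Gen.x • e i = e (i + 1)) :
    Function.Injective fun v : M => gen q f g Gen.x • v :=
  he.injective_of_mem_range fun i => ⟨e (i - 1), by rw [hx, sub_add_cancel]⟩

theorem nonempty_equiv_of_x (he : WeightCycle q f g N lam mu γ e)
    (hx : ∀ i, gen q f g Gen.x • e i = e (i + 1)) {e' : ℤ → M'}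
    (he' : WeightCycle q f g N lam mu γ e')
    (hx' : ∀ i, gen q f g Gen.x • e' i = e' (i + 1)) : Nonempty (M ≃ₗ[Alg q f g] M') := by
  obtain ⟨φ, hφ⟩ := he.exists_equiv he'
  refine ⟨equivOfGen q f g φ fun a => ?_⟩
  refine map_gen_smul_of_span he.span_eq_top φ.toLinearMap a fun i => ?_
  simp only [LinearEquiv.coe_coe]
  cases a with
  | x => rw [hx, hφ, hφ, hx']
  | y => rw [he.y_smul_of_x hx, map_smul, hφ, hφ, he'.y_smul_of_x hx']
  | h => rw [he.h_smul, map_smul, hφ, he'.h_smul]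

end XShift

/-! ### Cycles shifted by `y` -/

section YShift

theorem x_smul_of_y (he : WeightCycle q f g N lam mu γ e)
    (hy : ∀ i, gen q f g Gen.y • e i = e (i - 1)) (i : ℤ) :
    gen q f g Gen.x • e i = mu (i + 1) • e (i + 1) := by
  rw [← he.xy_smul, hy, add_sub_cancel_right]

theorem y_pow_smul (hy : ∀ i, gen q f g Gen.y • e i = e (i - 1)) (m : ℕ) (i : ℤ) :
    gen q f g Gen.y ^ m • e i = e (i - m) := by
  induction m with
  | zero => simp
  | succ m ih => rw [pow_succ', mul_smul, ih, hy, Nat.cast_succ, sub_add_eq_sub_sub]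

theorem simple_of_y (he : WeightCycle q f g N lam mu γ e)
    (hy : ∀ i, gen q f g Gen.y • e i = e (i - 1)) : IsSimpleModule (Alg q f g) M := by
  refine he.simple_of_mem fun K i hi j => ?_
  obtain ⟨m, l, hm⟩ := he.exists_nat_eq (i - j)
  have := K.smul_mem (gen q f g Gen.y ^ m) hi
  rw [y_pow_smul hy, hm, show i - (i - j + l * N) = j + (-l) * N by ring] at this
  exact he.mem_of_mem_add _ this

theorem y_injective (he : WeightCycle q f g N lam mu γ e)
    (hy : ∀ i, gen q f g Gen.y • e i = e (i - 1)) :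
    Function.Injective fun v : M => gen q f g Gen.y • v :=
  he.injective_of_mem_range fun i => ⟨e (i + 1), by rw [hy, add_sub_cancel_right]⟩

theorem x_not_injective (he : WeightCycle q f g N lam mu γ e)
    (hy : ∀ i, gen q f g Gen.y • e i = e (i - 1)) {i : ℤ} (hi : mu i = 0) :
    ¬ Function.Injective fun v : M => gen q f g Gen.x • v := fun h =>
  he.ne_zero (i - 1) (h (by
    change gen q f g Gen.x • e (i - 1) = gen q f g Gen.x • 0
    rw [he.x_smul_of_y hy, sub_add_cancel, hi, zero_smul, smul_zero]))

/-- Since `x e (i - 1) = mu i • e i`, nonvanishing of `mu` would put every `e i` in the image of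
`x`. With `x_not_injective`, the extra condition in list (b) says exactly that `x` is not injective.
-/
theorem exists_mu_eq_zero (he : WeightCycle q f g N lam mu γ e)
    (hy : ∀ i, gen q f g Gen.y • e i = e (i - 1))
    (hx : ¬ Function.Injective fun v : M => gen q f g Gen.x • v) :
    ∃ i : ℕ, i < N ∧ mu i = 0 := by
  by_contra! h
  refine hx (he.injective_of_mem_range fun i => ?_)
  have h0 : mu i ≠ 0 := by
    obtain ⟨r, k, rfl⟩ := he.exists_fin i
    have := (show Function.Periodic mu N from he.mu_add).int_mul k (r : ℕ)
    rw [Int.cast_id] at this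
    rw [this]
    exact h r r.2
  exact ⟨(mu i)⁻¹ • e (i - 1), by
    rw [smul_comm, he.x_smul_of_y hy, sub_add_cancel, smul_smul, inv_mul_cancel₀ h0, one_smul]⟩

theorem nonempty_equiv_of_y (he : WeightCycle q f g N lam mu γ e)
    (hy : ∀ i, gen q f g Gen.y • e i = e (i - 1)) {e' : ℤ → M'}
    (he' : WeightCycle q f g N lam mu γ e')
    (hy' : ∀ i, gen q f g Gen.y • e' i = e' (i - 1)) : Nonempty (M ≃ₗ[Alg q f g] M') := by
  obtain ⟨φ, hφ⟩ := he.exists_equiv he'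
  refine ⟨equivOfGen q f g φ fun a => ?_⟩
  refine map_gen_smul_of_span he.span_eq_top φ.toLinearMap a fun i => ?_
  simp only [LinearEquiv.coe_coe]
  cases a with
  | x => rw [he.x_smul_of_y hy, map_smul, hφ, hφ, he'.x_smul_of_y hy']
  | y => rw [hy, hφ, hφ, hy']
  | h => rw [he.h_smul, map_smul, hφ, he'.h_smul]

end YShift

theorem exists_shift (he : WeightCycle q f g N lam mu γ e)
    (he' : WeightCycle q f g N lam' mu' γ' e') (hl : lam ∈ SF f) (hl' : lam' ∈ SF f)
    (hm : mu ∈ TF q g lam) (hm' : mu' ∈ TF q g lam') (φ : M ≃ₗ[Alg q f g] M') :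
    ∃ j : ℤ, (∃ c : F, c ≠ 0 ∧ φ (e 0) = c • e' j) ∧
      ∃ j : ℤ, ∀ i : ℤ, lam' i = lam (i + j) ∧ mu' i = mu (i + j) := by
  obtain ⟨c, j, hc, hφ, h1, h2⟩ := he.shift_of_equiv he' φ
  -- The two shifts are opposite: the vector `e 0` goes to the line of `e' j`, so `lam' i = lam (i -
  -- j)`.
  refine ⟨j, ⟨c, hc, hφ⟩, -j, fun i => ?_⟩
  have := eq_of_eq_at hl' hl hm' hm he.pos he'.lam_add he.lam_add he'.mu_add he.mu_add h1 h2
    (i - j)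
  rwa [add_sub_cancel, zero_add, sub_eq_add_neg] at this

/-- An isomorphism preserves `γ` because `x ^ N` multiplies every member of the cycle by `γ`. -/
theorem nonempty_equiv_iff_of_x (he : WeightCycle q f g N lam mu γ e)
    (he' : WeightCycle q f g N lam' mu' γ' e') (hl : lam ∈ SF f) (hl' : lam' ∈ SF f)
    (hm : mu ∈ TF q g lam) (hm' : mu' ∈ TF q g lam')
    (hx : ∀ i, gen q f g Gen.x • e i = e (i + 1))
    (hx' : ∀ i, gen q f g Gen.x • e' i = e' (i + 1)) :
    Nonempty (M ≃ₗ[Alg q f g] M') ↔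
      γ = γ' ∧ ∃ j : ℤ, ∀ i : ℤ, lam' i = lam (i + j) ∧ mu' i = mu (i + j) := by
  constructor
  · rintro ⟨φ⟩
    obtain ⟨j, ⟨c, hc, hφ⟩, h⟩ := he.exists_shift he' hl hl' hm hm' φ
    refine ⟨?_, h⟩
    have h1 := congrArg φ (x_pow_smul hx N 0)
    rw [map_smul, hφ, smul_comm, x_pow_smul hx', he.add_period, he'.add_period, equiv_smul_F, hφ,
      smul_comm] at h1
    exact (smul_left_injective F (smul_ne_zero hc (he'.ne_zero j)) h1).symm
  · rintro ⟨rfl, j, h⟩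
    obtain rfl : lam' = fun i => lam (i + j) := funext fun i => (h i).1
    obtain rfl : mu' = fun i => mu (i + j) := funext fun i => (h i).2
    exact (he.of_add_left j).nonempty_equiv_of_x
      (fun i => by rw [hx, add_right_comm]) he' hx'

theorem nonempty_equiv_iff_of_y (he : WeightCycle q f g N lam mu γ e)
    (he' : WeightCycle q f g N lam' mu' γ' e') (hl : lam ∈ SF f) (hl' : lam' ∈ SF f)
    (hm : mu ∈ TF q g lam) (hm' : mu' ∈ TF q g lam')
    (hy : ∀ i, gen q f g Gen.y • e i = e (i - 1))
    (hy' : ∀ i, gen q f g Gen.y • e' i = e' (i - 1)) :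
    Nonempty (M ≃ₗ[Alg q f g] M') ↔
      γ = γ' ∧ ∃ j : ℤ, ∀ i : ℤ, lam' i = lam (i + j) ∧ mu' i = mu (i + j) := by
  constructor
  · rintro ⟨φ⟩
    obtain ⟨j, ⟨c, hc, hφ⟩, h⟩ := he.exists_shift he' hl hl' hm hm' φ
    refine ⟨?_, h⟩
    -- Here `y ^ N` acts by the inverse of `γ`; starting one period higher gives `y ^ N • γ • e 0 =
    -- e 0` and avoids the inverse.
    have h1 := congrArg φ (y_pow_smul hy N (0 + N))
    have h2 := y_pow_smul hy' N (j + N)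
    rw [he.add_period, add_sub_cancel_right, map_smul, equiv_smul_F, hφ, smul_comm _ γ,
      smul_comm _ c] at h1
    rw [he'.add_period, add_sub_cancel_right, smul_comm] at h2
    have h3 : γ • c • gen q f g Gen.y ^ N • e' j = γ' • c • gen q f g Gen.y ^ N • e' j := by
      rw [h1, smul_comm γ', h2]
    refine smul_left_injective F (smul_ne_zero hc fun h => he'.ne_zero j ?_) h3
    rw [← h2, h, smul_zero]
  · rintro ⟨rfl, j, h⟩
    obtain rfl : lam' = fun i => lam (i + j) := funext fun i => (h i).1
    obtain rfl : mu' = fun i => mu (i + j) := funext fun i => (h i).2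
    exact (he.of_add_left j).nonempty_equiv_of_y
      (fun i => by rw [hy, sub_add_eq_add_sub]) he' hy'

end WeightCycle

end Cycle

/-! ### The cyclic families of the quotients of `A(λ,μ)` and `B(λ,μ)` -/

section Quotients

variable {F : Type u} [Field F]

theorem T_add_sub_smul_T_mem (N : ℕ) (γ : F) (i : ℤ) :
    (LaurentPolynomial.T (i + N) - γ • LaurentPolynomial.T i : F[T;T⁻¹]) ∈
      Ideal.span {(LaurentPolynomial.T N - LaurentPolynomial.C γ : F[T;T⁻¹])} :=
  Ideal.mem_span_singleton'.2 ⟨LaurentPolynomial.T i, by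
    rw [mul_sub, ← LaurentPolynomial.T_add, mul_comm _ (LaurentPolynomial.C γ),
      LaurentPolynomial.smul_eq_C_mul]⟩

/-- Evaluation at an `N`-th root of `γ` kills the ideal but not the unit `t ^ i`. -/
theorem T_notMem [IsAlgClosed F] {N : ℕ} (hN : 0 < N) {γ : F} (hγ : γ ≠ 0) (i : ℤ) :
    (LaurentPolynomial.T i : F[T;T⁻¹]) ∉
      Ideal.span {(LaurentPolynomial.T N - LaurentPolynomial.C γ : F[T;T⁻¹])} := by
  intro h
  obtain ⟨c, hc⟩ := IsAlgClosed.exists_pow_nat_eq γ hN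
  have hc0 : c ≠ 0 := by
    rintro rfl
    exact hγ (by rw [← hc, zero_pow hN.ne'])
  obtain ⟨a, ha⟩ := Ideal.mem_span_singleton'.1 h
  have := congrArg (LaurentPolynomial.eval₂ (RingHom.id F) (Units.mk0 c hc0)) ha
  rw [map_mul, map_sub, LaurentPolynomial.eval₂_T, LaurentPolynomial.eval₂_T,
    LaurentPolynomial.eval₂_C] at this
  simp only [zpow_natCast, Units.val_pow_eq_pow_val, Units.val_mk0, hc, RingHom.id_apply, sub_self,
    mul_zero] at this
  exact (Units.mk0 c hc0 ^ i).ne_zero this.symm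

theorem span_range_T :
    Submodule.span F (Set.range fun i => (LaurentPolynomial.T i : F[T;T⁻¹])) = ⊤ := by
  rw [← (AddMonoidAlgebra.basis ℤ F).span_eq]
  congr 2

variable {q : F} {f g : F[X]} (lam : SF f) (mu : TF q g lam)

theorem weightCycle_quoA [IsAlgClosed F] {γ : F} (hγ : γ ≠ 0) (hN : 0 < per lam.1 mu.1) :
    WeightCycle q f g (per lam.1 mu.1) lam.1 mu.1 γ
      fun i => (Submodule.Quotient.mk (monA lam mu i) : QuoA lam mu γ) where
  pos := hN
  ne_zero i h := T_notMem hN hγ i ((Submodule.Quotient.mk_eq_zero (subA lam mu γ)).1 h)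
  add_period i := (Submodule.Quotient.eq (subA lam mu γ)).2 (T_add_sub_smul_T_mem _ _ _)
  h_smul i := by rw [← Submodule.Quotient.mk_smul, h_monA, Submodule.Quotient.mk_smul]
  xy_smul i := by
    rw [← Submodule.Quotient.mk_smul, ← Submodule.Quotient.mk_smul, y_monA, smul_comm, x_monA,
      sub_add_cancel, Submodule.Quotient.mk_smul]
  separated := per_dvd_sub lam.2 mu.2 hN
  span_eq_top := span_range_mk_eq_top _ (e := monA lam mu) span_range_T

theorem x_smul_quoA (γ : F) (i : ℤ) :
    gen q f g Gen.x • (Submodule.Quotient.mk (monA lam mu i) : QuoA lam mu γ) =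
      Submodule.Quotient.mk (monA lam mu (i + 1)) := by
  rw [← Submodule.Quotient.mk_smul, x_monA]

theorem weightCycle_quoB [IsAlgClosed F] {γ : F} (hγ : γ ≠ 0) (hN : 0 < per lam.1 mu.1) :
    WeightCycle q f g (per lam.1 mu.1) lam.1 mu.1 γ
      fun i => (Submodule.Quotient.mk (monB lam mu i) : QuoB lam mu γ) where
  pos := hN
  ne_zero i h := T_notMem hN hγ i ((Submodule.Quotient.mk_eq_zero (subB lam mu γ)).1 h)
  add_period i := (Submodule.Quotient.eq (subB lam mu γ)).2 (T_add_sub_smul_T_mem _ _ _)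
  h_smul i := by rw [← Submodule.Quotient.mk_smul, h_monB, Submodule.Quotient.mk_smul]
  xy_smul i := by
    rw [← Submodule.Quotient.mk_smul, ← Submodule.Quotient.mk_smul, y_monB, x_monB,
      sub_add_cancel, Submodule.Quotient.mk_smul]
  separated := per_dvd_sub lam.2 mu.2 hN
  span_eq_top := span_range_mk_eq_top _ (e := monB lam mu) span_range_T

theorem y_smul_quoB (γ : F) (i : ℤ) :
    gen q f g Gen.y • (Submodule.Quotient.mk (monB lam mu i) : QuoB lam mu γ) =
      Submodule.Quotient.mk (monB lam mu (i - 1)) := by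
  rw [← Submodule.Quotient.mk_smul, y_monB]

end Quotients

/-! ### Existence of cyclic families -/

section Existence

variable {F : Type u} [Field F] {q : F} {f g : F[X]}

/-- The action of an invertible shift on the joint eigenvalues of `h` and `xy`. -/
def weightMap (q : F) (f g : F[X]) (p : F × F) : F × F :=
  (f.eval p.1, q * p.2 + g.eval p.1)

theorem exists_periodic_sequences {p : F × F}
    (hp : 0 < Function.minimalPeriod (weightMap q f g) p) :
    ∃ lam ∈ SF f, ∃ mu ∈ TF q g lam,
      per lam mu = Function.minimalPeriod (weightMap q f g) p ∧
      (∀ i j, lam i = lam j → mu i = mu j → (per lam mu : ℤ) ∣ i - j) ∧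
      ∀ m : ℕ, (weightMap q f g)^[m] p = (lam m, mu m) := by
  set φ := weightMap q f g
  set N := Function.minimalPeriod φ p with hNdef
  have hN : (0 : ℤ) < N := by exact_mod_cast hp
  -- `weightMap` need not be invertible, so the orbit is extended to negative indices by reduction
  -- modulo the period.
  set P : ℤ → F × F := fun i => φ^[(i % N).toNat] p with hP
  have hr : ∀ i : ℤ, ((i % N).toNat : ℤ) = i % N := fun i =>
    Int.toNat_of_nonneg (Int.emod_nonneg i hN.ne')
  have key : ∀ (i : ℤ) (m : ℕ), (m : ℤ) % N = i % N → φ^[m] p = P i := by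
    intro i m h
    rw [hP, ← Function.iterate_mod_minimalPeriod_eq, ← hNdef]
    congr 2
    have := hr i
    rw [← h, ← Int.natCast_mod] at this
    rw [← h, ← Int.natCast_mod, Int.toNat_natCast]
  have succ : ∀ i, P (i + 1) = φ (P i) := by
    intro i
    rw [← key (i + 1) ((i % N).toNat + 1), Function.iterate_succ_apply']
    rw [Nat.cast_succ, hr, Int.emod_add_emod]
  have sep : ∀ i j, P i = P j → (N : ℤ) ∣ i - j := by
    intro i j h
    have lt : ∀ i : ℤ, (i % N).toNat < N := fun i => by
      have h1 := Int.emod_lt_of_pos i hN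
      have h2 := hr i
      omega
    have h1 := (Function.iterate_eq_iterate_iff_of_lt_minimalPeriod (lt i) (lt j)).1 h
    have h2 : i % N = j % N := (hr i).symm.trans ((congrArg Nat.cast h1).trans (hr j))
    exact Int.dvd_of_emod_eq_zero (Int.emod_eq_emod_iff_emod_sub_eq_zero.1 h2)
  have add : ∀ i, P (i + N) = P i := fun i => by simp only [hP, Int.add_emod_right]
  have hmu : (fun i => (P i).2) ∈ TF q g fun i => (P i).1 := fun i => by
    simp only [succ]
    rfl
  have hs : ∀ i j, (P i).1 = (P j).1 → (P i).2 = (P j).2 → (N : ℤ) ∣ i - j :=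
    fun i j h h' => sep i j (Prod.ext h h')
  have hper : per (fun i => (P i).1) (fun i => (P i).2) = N :=
    per_eq hmu (fun i => by simp only [add]) (by simpa using congrArg Prod.snd (add 0)) hs
  refine ⟨fun i => (P i).1, fun i => ?_, fun i => (P i).2, hmu, hper, ?_, fun m => key m m rfl⟩
  · simp only [succ]
    rfl
  · rw [hper]
    exact hs

variable {M : Type*} [AddCommGroup M] [Module F M] [Module (Alg q f g) M]
  [IsScalarTower F (Alg q f g) M]

variable (M) in
/-- The joint eigenspaces of `h` and `xy`. -/
noncomputable def weightSpace (q : F) (f g : F[X]) [Module (Alg q f g) M]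
    [IsScalarTower F (Alg q f g) M] (p : F × F) : Submodule F M :=
  (genEnd M q f g Gen.h).eigenspace p.1 ⊓
    (genEnd M q f g Gen.x * genEnd M q f g Gen.y).eigenspace p.2

theorem mem_weightSpace {p : F × F} {v : M} : v ∈ weightSpace M q f g p ↔
    gen q f g Gen.h • v = p.1 • v ∧ gen q f g Gen.x • gen q f g Gen.y • v = p.2 • v := by
  rw [weightSpace, Submodule.mem_inf, Module.End.mem_eigenspace_iff,
    Module.End.mem_eigenspace_iff]
  rfl

theorem finite_weights [FiniteDimensional F M] : {p | weightSpace M q f g p ≠ ⊥}.Finite := by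
  refine ((Module.End.finite_hasEigenvalue (genEnd M q f g Gen.h)).prod
    (Module.End.finite_hasEigenvalue (genEnd M q f g Gen.x * genEnd M q f g Gen.y))).subset ?_
  intro p hp
  exact ⟨fun h => hp (by rw [weightSpace, Module.End.eigenspace, h, bot_inf_eq]),
    fun h => hp (by
      rw [weightSpace]
      exact (congrArg _ h).trans (inf_bot_eq _))⟩

theorem genEnd_commute : Commute (genEnd M q f g Gen.h)
    (genEnd M q f g Gen.x * genEnd M q f g Gen.y) := by
  have := h_commute_xy (q := q) (f := f) (g := g)
  have := this.map (Algebra.lsmul F F M : Alg q f g →ₐ[F] Module.End F M)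
  rwa [map_mul] at this

variable [IsAlgClosed F] [FiniteDimensional F M] [Nontrivial M]

theorem exists_weight : ∃ p, weightSpace M q f g p ≠ ⊥ := by
  obtain ⟨w, -, h0, ⟨a, ha⟩, b, hb⟩ := exists_joint_eigenvector_mem (⊤ : Submodule F M) top_ne_bot
    _ _ (fun _ _ => trivial) (fun _ _ => trivial) (genEnd_commute (q := q) (f := f) (g := g))
  exact ⟨(a, b), (Submodule.ne_bot_iff _).2 ⟨w, mem_weightSpace.2 ⟨ha, hb⟩, h0⟩⟩

/-- An invertible operator that moves joint eigenvectors along `weightMap` yields a family of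
joint eigenvectors. -/
theorem exists_weightCycle (S : M ≃ₗ[F] M)
    (hS : ∀ p, ∀ v ∈ weightSpace M q f g p, S v ∈ weightSpace M q f g (weightMap q f g p))
    (hspan : ∀ (lam mu : ℤ → F) (e : ℤ → M), (∀ i, e i ≠ 0) → (∀ i, S (e i) = e (i + 1)) →
      (∀ i, gen q f g Gen.h • e i = lam i • e i) →
      (∀ i, gen q f g Gen.x • gen q f g Gen.y • e i = mu i • e i) →
      Submodule.span F (Set.range e) = ⊤) :
    ∃ lam ∈ SF f, ∃ mu ∈ TF q g lam, ∃ (γ : F) (e : ℤ → M),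
      WeightCycle q f g (per lam mu) lam mu γ e ∧ ∀ i, S (e i) = e (i + 1) := by
  have hpow : ∀ (m : ℕ) p, ∀ v ∈ weightSpace M q f g p,
      (S ^ m) v ∈ weightSpace M q f g ((weightMap q f g)^[m] p) := by
    intro m p v hv
    induction m with
    | zero => simpa using hv
    | succ m ih =>
      rw [pow_succ', Function.iterate_succ_apply']
      exact hS _ _ ih
  have hne : ∀ (m : ℕ) p, weightSpace M q f g p ≠ ⊥ →
      weightSpace M q f g ((weightMap q f g)^[m] p) ≠ ⊥ := by
    intro m p hp
    obtain ⟨v, hv, h0⟩ := (Submodule.ne_bot_iff _).1 hp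
    exact (Submodule.ne_bot_iff _).2 ⟨_, hpow m p v hv, fun h => h0 ((S ^ m).map_eq_zero_iff.1 h)⟩
  -- Otherwise the iterates of a weight would be infinitely many distinct weights: if the `i`-th and
  -- a later `j`-th iterate agree, the `i`-th is periodic. This contradicts `finite_weights`.
  obtain ⟨p, hp, hN⟩ : ∃ p, weightSpace M q f g p ≠ ⊥ ∧
      0 < Function.minimalPeriod (weightMap q f g) p := by
    obtain ⟨p, hp⟩ := exists_weight (M := M) (q := q) (f := f) (g := g)
    by_contra! h
    refine Set.infinite_of_injective_forall_mem (f := fun m => (weightMap q f g)^[m] p) ?_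
      (fun m => hne m p hp) finite_weights
    intro i j hij
    by_contra hne'
    wlog hlt : i < j generalizing i j
    · exact this hij.symm (Ne.symm hne') (by omega)
    have hper : Function.IsPeriodicPt (weightMap q f g) (j - i) ((weightMap q f g)^[i] p) := by
      rw [Function.IsPeriodicPt, Function.IsFixedPt, ← Function.iterate_add_apply,
        Nat.sub_add_cancel hlt.le]
      exact hij.symm
    exact (hper.minimalPeriod_pos (by omega)).not_ge (h _ (hne i p hp))
  obtain ⟨lam, hlam, mu, hmu, hper, hsep, hP⟩ := exists_periodic_sequences hN
  rw [← hper] at hN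
  set N := per lam mu with hNdef
  -- `S ^ N` maps the weight space of the periodic weight `p` to itself; its eigenvalue there
  -- becomes the parameter `γ`.
  obtain ⟨w, hw, h0, γ, hγ⟩ := exists_eigenvector_mem (weightSpace M q f g p) hp
    (S ^ N).toLinearMap (fun v hv => by
      have := hpow N p v hv
      rw [show (weightMap q f g)^[N] p = p by rw [hper]; exact Function.iterate_minimalPeriod] at this
      exact this)
  replace hγ : (S ^ N) w = γ • w := hγ
  have hγ0 : γ ≠ 0 := by
    rintro rfl
    rw [zero_smul] at hγ
    exact h0 ((S ^ N).map_eq_zero_iff.1 hγ)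
  set e : ℤ → M := fun i => (S ^ i) w with he
  have hSe : ∀ i, S (e i) = e (i + 1) := fun i => by
    simp only [he]
    rw [add_comm, zpow_one_add]
    rfl
  have hadd : ∀ i, e (i + N) = γ • e i := fun i => by
    simp only [he]
    rw [zpow_add, zpow_natCast, LinearEquiv.mul_apply, hγ, map_smul]
  have hadd' : ∀ (i : ℤ) (m : ℕ), e (i + m * N) = γ ^ m • e i := by
    intro i m
    induction m with
    | zero => simp
    | succ m ih =>
      rw [show i + ((m + 1 : ℕ) : ℤ) * N = i + m * N + N by push_cast; ring, hadd, ih, smul_smul,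
        pow_succ']
  have hmem : ∀ i, e i ∈ weightSpace M q f g (lam i, mu i) := by
    intro i
    -- `hpow` covers natural exponents only. Moving `i` up by whole periods scales `e i` by a power
    -- of `γ` and leaves the weight unchanged.
    obtain ⟨m, hm⟩ : ∃ m : ℕ, (m : ℤ) = i + i.natAbs * N := by
      refine ⟨(i + i.natAbs * N).toNat, Int.toNat_of_nonneg ?_⟩
      have h1 : (i.natAbs : ℤ) ≤ i.natAbs * N := le_mul_of_one_le_right (by omega) (by omega)
      omega
    have h1 := hpow m p w hw
    have pl := (show Function.Periodic lam N from lam_add_per lam mu).int_mul i.natAbs i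
    have pm := (show Function.Periodic mu N from mu_add_per hmu).int_mul i.natAbs i
    rw [Int.cast_id] at pl pm
    rw [hP, ← zpow_natCast, hm, pl, pm] at h1
    have h2 := hadd' i i.natAbs
    simp only [he] at h2 ⊢
    rw [h2] at h1
    exact (Submodule.smul_mem_iff _ (pow_ne_zero _ hγ0)).1 h1
  have hne : ∀ i, e i ≠ 0 := fun i h => h0 ((S ^ i).map_eq_zero_iff.1 h)
  have hh : ∀ i, gen q f g Gen.h • e i = lam i • e i := fun i => (mem_weightSpace.1 (hmem i)).1
  have hz : ∀ i, gen q f g Gen.x • gen q f g Gen.y • e i = mu i • e i :=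
    fun i => (mem_weightSpace.1 (hmem i)).2
  exact ⟨lam, hlam, mu, hmu, γ, e,
    ⟨hN, hne, hadd, hh, hz, hsep, hspan lam mu e hne hSe hh hz⟩, hSe⟩

theorem exists_weightCycle_of_x_injective [IsSimpleModule (Alg q f g) M]
    (hx : Function.Injective fun v : M => gen q f g Gen.x • v) :
    ∃ lam ∈ SF f, ∃ mu ∈ TF q g lam, ∃ (γ : F) (e : ℤ → M),
      WeightCycle q f g (per lam mu) lam mu γ e ∧ ∀ i, gen q f g Gen.x • e i = e (i + 1) := by
  refine exists_weightCycle (LinearEquiv.ofInjectiveEndo (genEnd M q f g Gen.x) hx)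
    (fun p v hv => ?_) fun lam mu e h0 hSe hh hz => ?_
  · obtain ⟨ha, hb⟩ := mem_weightSpace.1 hv
    refine mem_weightSpace.2 ⟨h_x_smul ha, ?_⟩
    change gen q f g Gen.x • gen q f g Gen.y • gen q f g Gen.x • v = _
    rw [y_x_smul ha hb, smul_comm]
    rfl
  · refine span_range_eq_top q f g e (fun a i => ?_) (h0 0)
    replace hSe : ∀ i, gen q f g Gen.x • e i = e (i + 1) := hSe
    cases a with
    | x => exact ⟨1, i + 1, by rw [hSe, one_smul]⟩
    | y =>
      refine ⟨_, i - 1, Eq.trans ?_ (y_x_smul (hh (i - 1)) (hz (i - 1)))⟩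
      rw [hSe, sub_add_cancel]
    | h => exact ⟨_, _, hh i⟩

/-- The shift is the inverse of `y`. That it moves weights along `weightMap` is checked after
applying the injective operator `y`. -/
theorem exists_weightCycle_of_y_injective [IsSimpleModule (Alg q f g) M]
    (hy : Function.Injective fun v : M => gen q f g Gen.y • v) :
    ∃ lam ∈ SF f, ∃ mu ∈ TF q g lam, ∃ (γ : F) (e : ℤ → M),
      WeightCycle q f g (per lam mu) lam mu γ e ∧ ∀ i, gen q f g Gen.y • e i = e (i - 1) := by
  set S := (LinearEquiv.ofInjectiveEndo (genEnd M q f g Gen.y) hy).symm with hSdef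
  have hS : ∀ v, gen q f g Gen.y • S v = v := fun v =>
    (LinearEquiv.ofInjectiveEndo (genEnd M q f g Gen.y) hy).apply_symm_apply v
  have hyS : ∀ e : ℤ → M, (∀ i, S (e i) = e (i + 1)) → ∀ i, gen q f g Gen.y • e i = e (i - 1) := by
    intro e he i
    have := hS (e (i - 1))
    rwa [he, sub_add_cancel] at this
  obtain ⟨lam, hl, mu, hm, γ, e, he, hSe⟩ := exists_weightCycle (q := q) (f := f) (g := g) S
    (fun p v hv => by
      obtain ⟨ha, hb⟩ := mem_weightSpace.1 hv
      refine mem_weightSpace.2 ⟨hy ?_, hy ?_⟩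
      · change gen q f g Gen.y • gen q f g Gen.h • S v = gen q f g Gen.y • f.eval p.1 • S v
        rw [← mul_smul, gen_y_mul_gen_h, mul_smul, hS, smul_comm, hS, aeval_gen_smul ha]
      · change gen q f g Gen.y • gen q f g Gen.x • gen q f g Gen.y • S v =
          gen q f g Gen.y • (q * p.2 + g.eval p.1) • S v
        rw [hS, y_x_smul ha hb, smul_comm, hS])
    (fun lam mu e h0 hSe hh hz => by
      refine span_range_eq_top q f g e (fun a i => ?_) (h0 0)
      cases a with
      | x =>
        refine ⟨mu (i + 1), i + 1, ?_⟩
        rw [← hz, hyS e hSe, add_sub_cancel_right]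
      | y => exact ⟨1, i - 1, by rw [hyS e hSe, one_smul]⟩
      | h => exact ⟨_, _, hh i⟩)
  exact ⟨lam, hl, mu, hm, γ, e, he, hyS e hSe⟩

end Existence

/-! ### Nilpotent chains -/

section Chain

variable {F : Type u} [Field F] {q : F} {f g : F[X]}
variable {M : Type*} [AddCommGroup M] [Module F M] [Module (Alg q f g) M]
  [IsScalarTower F (Alg q f g) M]

/-- The three formulas need one joint induction: the weight of `e i` gives `y e (i + 1) = y x e i`,
which in turn gives the next eigenvalue of `xy`. -/
theorem chain_weights {α : F} {e : ℕ → M} (h0 : gen q f g Gen.h • e 0 = α • e 0)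
    (y0 : gen q f g Gen.y • e 0 = 0) (hx : ∀ i, gen q f g Gen.x • e i = e (i + 1)) (i : ℕ) :
    gen q f g Gen.h • e i = iter f α i • e i ∧
      gen q f g Gen.x • gen q f g Gen.y • e i = nu q f g α i • e i ∧
      gen q f g Gen.y • e (i + 1) = nu q f g α (i + 1) • e i := by
  have y_succ : ∀ i, gen q f g Gen.h • e i = iter f α i • e i →
      gen q f g Gen.x • gen q f g Gen.y • e i = nu q f g α i • e i →
      gen q f g Gen.y • e (i + 1) = nu q f g α (i + 1) • e i := fun i hh hz => by
    rw [← hx, y_x_smul hh hz, nu]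
  induction i with
  | zero =>
    have hz : gen q f g Gen.x • gen q f g Gen.y • e 0 = nu q f g α 0 • e 0 := by
      rw [y0, smul_zero, nu, zero_smul]
    exact ⟨h0, hz, y_succ 0 h0 hz⟩
  | succ i ih =>
    have hh : gen q f g Gen.h • e (i + 1) = iter f α (i + 1) • e (i + 1) := by
      rw [← hx, h_x_smul ih.1, iter_succ]
    have hz : gen q f g Gen.x • gen q f g Gen.y • e (i + 1) = nu q f g α (i + 1) • e (i + 1) := by
      rw [ih.2.2, smul_comm, hx]
    exact ⟨hh, hz, y_succ _ hh hz⟩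

variable (q f g) in
/-- A spanning chain `e 0, x e 0, …` of length `n` that starts with an eigenvector of `h` in the
kernel of `y`. -/
structure NilChain (n : ℕ) (α : F) (e : ℕ → M) : Prop where
  pos : 0 < n
  ne_zero : e 0 ≠ 0
  h_zero : gen q f g Gen.h • e 0 = α • e 0
  y_zero : gen q f g Gen.y • e 0 = 0
  x_smul : ∀ i, gen q f g Gen.x • e i = e (i + 1)
  last : e n = 0
  nu_ne_zero : ∀ i, 1 ≤ i → i ≤ n - 1 → nu q f g α i ≠ 0
  span_eq_top : Submodule.span F (Set.range e) = ⊤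

theorem chain_eq_zero {e : ℕ → M} (hx : ∀ i, gen q f g Gen.x • e i = e (i + 1)) {n i : ℕ}
    (hn : e n = 0) (hi : n ≤ i) : e i = 0 := by
  induction i, hi using Nat.le_induction with
  | base => exact hn
  | succ i _ ih => rw [← hx, ih, smul_zero]

namespace NilChain

variable {n : ℕ} {α : F} {e : ℕ → M}

theorem h_smul (he : NilChain q f g n α e) (i : ℕ) :
    gen q f g Gen.h • e i = iter f α i • e i :=
  (chain_weights he.h_zero he.y_zero he.x_smul i).1

theorem y_succ (he : NilChain q f g n α e) (i : ℕ) :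
    gen q f g Gen.y • e (i + 1) = nu q f g α (i + 1) • e i :=
  (chain_weights he.h_zero he.y_zero he.x_smul i).2.2

theorem y_sum (he : NilChain q f g n α e) (c : ℕ → F) (m : ℕ) :
    gen q f g Gen.y • ∑ i ∈ Finset.range (m + 1), c i • e i =
      ∑ i ∈ Finset.range m, (c (i + 1) * nu q f g α (i + 1)) • e i := by
  rw [Finset.sum_range_succ', smul_add, smul_comm, he.y_zero, smul_zero, add_zero,
    Finset.smul_sum]
  refine Finset.sum_congr rfl fun i _ => ?_
  rw [smul_comm, he.y_succ, smul_smul]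

/-- Applying `y` shifts the coefficients down by one, up to nonzero factors `ν`, so induction kills
all but the zeroth; that one vanishes because `e 0 ∉ K`. With `K = ⊥` this gives independence and
the kernel of `y`, with general `K` simplicity. -/
theorem coeff_eq_zero (he : NilChain q f g n α e) (K : Submodule (Alg q f g) M) (hK : e 0 ∉ K)
    (m : ℕ) (hm : m ≤ n) (c : ℕ → F) (hc : ∑ i ∈ Finset.range m, c i • e i ∈ K) :
    ∀ i < m, c i = 0 := by
  induction m generalizing c with
  | zero => simp
  | succ m ih =>
    have h1 := K.smul_mem (gen q f g Gen.y) hc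
    rw [he.y_sum] at h1
    have h2 : ∀ i < m, c (i + 1) = 0 := fun i hi =>
      (mul_eq_zero.1 (ih (by omega) _ h1 i hi)).resolve_right
        (he.nu_ne_zero _ (by omega) (by omega))
    have h3 : c 0 = 0 := by
      rw [Finset.sum_range_succ', Finset.sum_eq_zero fun i hi => by
        rw [h2 i (Finset.mem_range.1 hi), zero_smul], zero_add] at hc
      by_contra h
      have := K.smul_mem (algebraMap F _ (c 0)⁻¹) hc
      rw [algebraMap_smul, smul_smul, inv_mul_cancel₀ h, one_smul] at this
      exact hK this
    intro i hi
    cases i with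
    | zero => exact h3
    | succ i => exact h2 i (by omega)

theorem linearIndependent (he : NilChain q f g n α e) :
    LinearIndependent F fun i : Fin n => e i := by
  rw [Fintype.linearIndependent_iff]
  intro c hc i
  have := he.coeff_eq_zero ⊥ (fun h => he.ne_zero ((Submodule.mem_bot _).1 h)) n le_rfl
    (fun i => if h : i < n then c ⟨i, h⟩ else 0) (by
      rw [Finset.sum_range, Submodule.mem_bot, ← hc]
      exact Finset.sum_congr rfl fun i _ => by simp) i i.2
  simpa using this

/-- The nonzero members of the chain form a basis. -/
noncomputable def basis (he : NilChain q f g n α e) : Module.Basis (Fin n) F M :=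
  Module.Basis.mk he.linearIndependent (by
    rw [← he.span_eq_top, Submodule.span_le]
    rintro _ ⟨i, rfl⟩
    by_cases hi : i < n
    · exact Submodule.subset_span ⟨⟨i, hi⟩, rfl⟩
    · rw [chain_eq_zero he.x_smul he.last (not_lt.1 hi)]
      exact Submodule.zero_mem _)

theorem basis_apply (he : NilChain q f g n α e) (i : Fin n) : he.basis i = e i := by
  rw [basis, Module.Basis.mk_apply]

theorem finrank_eq (he : NilChain q f g n α e) : Module.finrank F M = n := by
  rw [Module.finrank_eq_card_basis he.basis, Fintype.card_fin]

theorem exists_sum_eq (he : NilChain q f g n α e) (v : M) :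
    ∃ c : ℕ → F, ∑ i ∈ Finset.range n, c i • e i = v := by
  refine ⟨fun i => if h : i < n then he.basis.repr v ⟨i, h⟩ else 0, ?_⟩
  conv_rhs => rw [← he.basis.sum_repr v]
  rw [Finset.sum_range]
  exact Finset.sum_congr rfl fun i _ => by simp [he.basis_apply]

theorem simple (he : NilChain q f g n α e) : IsSimpleModule (Alg q f g) M := by
  refine simple_of_generator he.ne_zero (fun K hK => ?_) fun K hK => ?_
  · obtain ⟨v, hv, h0⟩ := (Submodule.ne_bot_iff _).1 hK
    obtain ⟨c, rfl⟩ := he.exists_sum_eq v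
    by_contra h
    have := he.coeff_eq_zero K h n le_rfl c hv
    exact h0 (Finset.sum_eq_zero fun i hi => by rw [this i (Finset.mem_range.1 hi), zero_smul])
  · have h1 : ∀ i, e i ∈ K := fun i => by
      induction i with
      | zero => exact hK
      | succ i ih => rw [← he.x_smul]; exact K.smul_mem _ ih
    refine eq_top_iff.2 fun v _ => ?_
    obtain ⟨c, rfl⟩ := he.exists_sum_eq v
    refine Submodule.sum_mem _ fun i _ => ?_
    rw [← algebraMap_smul (Alg q f g)]
    exact K.smul_mem _ (h1 i)

theorem last_ne_zero (he : NilChain q f g n α e) : e (n - 1) ≠ 0 := by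
  have := he.basis.ne_zero ⟨n - 1, by have := he.pos; omega⟩
  rwa [he.basis_apply] at this

theorem x_not_injective (he : NilChain q f g n α e) :
    ¬ Function.Injective fun v : M => gen q f g Gen.x • v := fun h =>
  he.last_ne_zero (h (by
    change gen q f g Gen.x • e (n - 1) = gen q f g Gen.x • 0
    rw [he.x_smul, Nat.sub_add_cancel he.pos, he.last, smul_zero]))

theorem y_not_injective (he : NilChain q f g n α e) :
    ¬ Function.Injective fun v : M => gen q f g Gen.y • v := fun h =>
  he.ne_zero (h (by
    change gen q f g Gen.y • e 0 = gen q f g Gen.y • 0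
    rw [he.y_zero, smul_zero]))

/-- The kernel of `y` is spanned by the first member of the chain. -/
theorem eq_smul_of_y_smul_eq_zero (he : NilChain q f g n α e) {v : M}
    (hv : gen q f g Gen.y • v = 0) : ∃ c : F, v = c • e 0 := by
  obtain ⟨c, rfl⟩ := he.exists_sum_eq v
  -- With `n = m + 1`, the image under `y` is a combination of the first `m` members, and its
  -- vanishing leaves only the zeroth coefficient of the vector.
  obtain ⟨m, rfl⟩ := Nat.exists_eq_add_of_le' he.pos
  rw [he.y_sum] at hv
  have := he.coeff_eq_zero ⊥ (fun h => he.ne_zero ((Submodule.mem_bot _).1 h)) m (by omega) _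
    ((Submodule.mem_bot _).2 hv)
  refine ⟨c 0, ?_⟩
  rw [Finset.sum_range_succ', Finset.sum_eq_zero, zero_add]
  intro i hi
  rw [(mul_eq_zero.1 (this i (Finset.mem_range.1 hi))).resolve_right
    (he.nu_ne_zero _ (by omega) (by have := Finset.mem_range.1 hi; omega)), zero_smul]

variable {M' : Type*} [AddCommGroup M'] [Module F M'] [Module (Alg q f g) M']
  [IsScalarTower F (Alg q f g) M'] {α' : F} {e' : ℕ → M'}

theorem nonempty_equiv (he : NilChain q f g n α e) (he' : NilChain q f g n α e') :
    Nonempty (M ≃ₗ[Alg q f g] M') := by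
  obtain ⟨φ, hφ⟩ : ∃ φ : M ≃ₗ[F] M', ∀ i, φ (e i) = e' i := by
    refine ⟨he.basis.equiv he'.basis (Equiv.refl _), fun i => ?_⟩
    by_cases hi : i < n
    · have := he.basis.equiv_apply ⟨i, hi⟩ he'.basis (Equiv.refl _)
      rwa [he.basis_apply, he'.basis_apply] at this
    · rw [chain_eq_zero he.x_smul he.last (not_lt.1 hi),
        chain_eq_zero he'.x_smul he'.last (not_lt.1 hi), map_zero]
  refine ⟨equivOfGen q f g φ fun a => ?_⟩
  refine map_gen_smul_of_span he.span_eq_top φ.toLinearMap a fun i => ?_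
  simp only [LinearEquiv.coe_coe]
  cases a with
  | x => rw [he.x_smul, hφ, hφ, he'.x_smul]
  | y =>
    cases i with
    | zero => rw [he.y_zero, hφ, he'.y_zero, map_zero]
    | succ i => rw [he.y_succ, map_smul, hφ, hφ, he'.y_succ]
  | h => rw [he.h_smul, map_smul, hφ, he'.h_smul]

/-- An isomorphism preserves the kernel of `y`, a line on which `h` acts by `α`. -/
theorem nonempty_equiv_iff (he : NilChain q f g n α e) (he' : NilChain q f g n α' e') :
    Nonempty (M ≃ₗ[Alg q f g] M') ↔ α = α' := by
  refine ⟨fun ⟨φ⟩ => ?_, fun h => he.nonempty_equiv (h ▸ he')⟩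
  have h0 : φ (e 0) ≠ 0 := fun h => he.ne_zero (φ.map_eq_zero_iff.1 h)
  obtain ⟨c, hc⟩ := he'.eq_smul_of_y_smul_eq_zero (v := φ (e 0))
    (by rw [← map_smul, he.y_zero, map_zero])
  refine smul_left_injective F h0 ?_
  change α • φ (e 0) = α' • φ (e 0)
  rw [← equiv_smul_F, ← he.h_zero, map_smul, hc, smul_comm, he'.h_zero, smul_comm]

end NilChain

theorem nilChain_quoC {n : ℕ} (hn : 0 < n) {α : F} (hα : nu q f g α n = 0)
    (h : ∀ i, 1 ≤ i → i ≤ n - 1 → nu q f g α i ≠ 0) :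
    NilChain q f g n α fun i => (Submodule.Quotient.mk (monC q f g α i) : QuoC hα) where
  pos := hn
  ne_zero h0 := by
    have h1 : (X ^ 0 : F[X]) ∈ Ideal.span {(X ^ n : F[X])} :=
      (Submodule.Quotient.mk_eq_zero (subC hα)).1 h0
    rw [Ideal.mem_span_singleton, pow_zero, ← isUnit_iff_dvd_one] at h1
    exact Polynomial.not_isUnit_X ((isUnit_pow_iff hn.ne').1 h1)
  h_zero := by rw [← Submodule.Quotient.mk_smul, h_monC, Submodule.Quotient.mk_smul]; rfl
  y_zero := by rw [← Submodule.Quotient.mk_smul, y_monC_zero, Submodule.Quotient.mk_zero]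
  x_smul i := by rw [← Submodule.Quotient.mk_smul, x_monC]
  last := (Submodule.Quotient.mk_eq_zero (subC hα)).2 
    (Ideal.mem_span_singleton_self (X ^ n : F[X]))
  nu_ne_zero := h
  span_eq_top := by
    have h1 : Submodule.span F (Set.range (monC q f g α)) = ⊤ := by
      refine Eq.trans ?_ (Polynomial.basisMonomials F).span_eq
      congr 2
      funext i
      rw [Polynomial.coe_basisMonomials]
      exact Polynomial.X_pow_eq_monomial i
    exact span_range_mk_eq_top _ h1

/-- In a simple module `x` is injective or nilpotent. -/
theorem x_nilpotent [FiniteDimensional F M] [IsSimpleModule (Alg q f g) M]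
    (hx : ¬ Function.Injective fun v : M => gen q f g Gen.x • v) :
    ∃ m : ℕ, genEnd M q f g Gen.x ^ m = 0 := by
  -- The intersection of the images of the powers of `x` is a submodule: each image is stable under
  -- `h` and `xy`, and `y` maps the image of `x ^ (i + 1)` into that of `x ^ i`. If the intersection
  -- is everything, `x` is surjective, hence injective; if it is zero, some power of `x` vanishes.
  set E := genEnd M q f g Gen.x with hE
  have mem_succ : ∀ {i : ℕ} {v : M}, v ∈ LinearMap.range (E ^ (i + 1)) ↔
      ∃ u ∈ LinearMap.range (E ^ i), gen q f g Gen.x • u = v := by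
    intro i v
    rw [pow_succ']
    constructor
    · rintro ⟨w, rfl⟩
      exact ⟨_, ⟨w, rfl⟩, rfl⟩
    · rintro ⟨_, ⟨w, rfl⟩, rfl⟩
      exact ⟨w, rfl⟩
  have aev : ∀ (K : Submodule F M), (∀ v ∈ K, gen q f g Gen.h • v ∈ K) → ∀ (p : F[X]),
      ∀ v ∈ K, aeval (gen q f g Gen.h) p • v ∈ K := by
    intro K hK p
    induction p using Polynomial.induction_on' with
    | add p r hp hr => intro v hv; rw [map_add, add_smul]; exact K.add_mem (hp v hv) (hr v hv)
    | monomial k a =>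
      intro v hv
      rw [Polynomial.aeval_monomial, mul_smul, algebraMap_smul]
      refine K.smul_mem _ ?_
      induction k with
      | zero => simpa using hv
      | succ k ih => rw [pow_succ', mul_smul]; exact hK _ ih
  have hh : ∀ i, ∀ v ∈ LinearMap.range (E ^ i), gen q f g Gen.h • v ∈ LinearMap.range (E ^ i) := by
    intro i
    induction i with
    | zero => simp
    | succ i ih =>
      intro v hv
      obtain ⟨u, hu, rfl⟩ := mem_succ.1 hv
      refine mem_succ.2 ⟨_, aev _ ih f u hu, ?_⟩
      rw [← mul_smul, ← mul_smul, gen_h_mul_gen_x]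
  have hyx : ∀ i, ∀ v ∈ LinearMap.range (E ^ i),
      gen q f g Gen.x • gen q f g Gen.y • v ∈ LinearMap.range (E ^ i) →
      gen q f g Gen.y • gen q f g Gen.x • v ∈ LinearMap.range (E ^ i) := by
    intro i v hv h
    rw [← mul_smul, gen_y_mul_gen_x, add_smul, smul_assoc, mul_smul]
    exact Submodule.add_mem _ (Submodule.smul_mem _ _ h) (aev _ (hh i) g v hv)
  have hz : ∀ i, ∀ v ∈ LinearMap.range (E ^ i),
      gen q f g Gen.x • gen q f g Gen.y • v ∈ LinearMap.range (E ^ i) := by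
    intro i
    induction i with
    | zero => simp
    | succ i ih =>
      intro v hv
      obtain ⟨u, hu, rfl⟩ := mem_succ.1 hv
      exact mem_succ.2 ⟨_, hyx i u hu (ih u hu), rfl⟩
  have hle : ∀ i, LinearMap.range (E ^ (i + 1)) ≤ LinearMap.range (E ^ i) := by
    intro i
    rw [pow_succ]
    exact LinearMap.range_comp_le_range _ _
  obtain ⟨m, hm⟩ := (LinearMap.eventually_iInf_range_pow_eq E).exists
  refine ⟨m, ?_⟩
  rw [← LinearMap.range_eq_bot, ← hm]
  by_contra hne
  obtain ⟨v, hv, h0⟩ := (Submodule.ne_bot_iff _).1 hne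
  have htop := eq_top_of_stable q f g (⨅ i, LinearMap.range (E ^ i)) (fun a v hv => by
    rw [Submodule.mem_iInf] at hv ⊢
    intro i
    cases a with
    | x => exact hle i (mem_succ.2 ⟨v, hv i, rfl⟩)
    | y =>
      obtain ⟨u, hu, rfl⟩ := mem_succ.1 (hv (i + 1))
      exact hyx i u hu (hz i u hu)
    | h => exact hh i v (hv i)) hv h0
  have h1 : LinearMap.range E = ⊤ := by
    rw [← top_le_iff, ← htop]
    exact (iInf_le _ 1).trans_eq (by rw [pow_one])
  exact hx (LinearMap.injective_iff_surjective.2 (LinearMap.range_eq_top.1 h1))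

/-- By `y h = f(h) y` the kernel of `y` is stable under `h` and contains an eigenvector of it. The
powers of `x` applied to that vector form the chain, which ends because `x` is nilpotent. -/
theorem exists_nilChain [IsAlgClosed F] [FiniteDimensional F M] [IsSimpleModule (Alg q f g) M]
    (hx : ¬ Function.Injective fun v : M => gen q f g Gen.x • v)
    (hy : ¬ Function.Injective fun v : M => gen q f g Gen.y • v) :
    ∃ (n : ℕ) (α : F) (e : ℕ → M), NilChain q f g n α e ∧ nu q f g α n = 0 := by
  obtain ⟨v, hv, h0, α, hα⟩ := exists_eigenvector_mem (LinearMap.ker (genEnd M q f g Gen.y))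
    (fun h => hy (LinearMap.ker_eq_bot.1 h)) (genEnd M q f g Gen.h) (fun w hw => by
      rw [LinearMap.mem_ker, genEnd_apply] at hw ⊢
      rw [genEnd_apply, ← mul_smul, gen_y_mul_gen_h, mul_smul, hw, smul_zero])
  set e : ℕ → M := fun i => gen q f g Gen.x ^ i • v with he
  have e0 : e 0 = v := by simp [he]
  have hxe : ∀ i, gen q f g Gen.x • e i = e (i + 1) := fun i => by
    simp only [he]
    rw [pow_succ', mul_smul]
  have hh0 : gen q f g Gen.h • e 0 = α • e 0 := by rw [e0]; exact hα
  have hy0 : gen q f g Gen.y • e 0 = 0 := by rw [e0]; exact hv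
  have hw := chain_weights hh0 hy0 hxe
  have hadd : ∀ m i, gen q f g Gen.x ^ m • e i = e (m + i) := fun m i => by
    simp only [he]
    rw [pow_add, mul_smul]
  have hex : ∃ m, e m = 0 := by
    obtain ⟨m, hm⟩ := x_nilpotent hx
    refine ⟨m, ?_⟩
    have := LinearMap.congr_fun hm v
    rwa [genEnd, ← map_pow] at this
  classical
  set n := Nat.find hex with hn
  have hlast : e n = 0 := Nat.find_spec hex
  have hmin : ∀ i < n, e i ≠ 0 := fun i hi => Nat.find_min hex hi
  have hpos : 0 < n := by
    rcases Nat.eq_zero_or_pos n with h | h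
    · rw [h, e0] at hlast
      exact absurd hlast h0
    · exact h
  -- If `ν(i) = 0`, then `y` kills `e i`, so the members from `i` on span a stable subspace. The
  -- case `i = 0` says that the whole chain spans.
  have tail : ∀ i < n, nu q f g α i = 0 →
      Submodule.span F (Set.range fun j => e (i + j)) = ⊤ := by
    intro i hi hi0
    refine span_range_eq_top q f g _ (fun a j => ?_) (i := 0) (hmin i hi)
    cases a with
    | x => exact ⟨1, j + 1, by rw [hxe, one_smul, add_assoc]⟩
    | y =>
      cases j with
      | zero =>
        refine ⟨0, 0, ?_⟩
        rw [zero_smul, add_zero]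
        cases i with
        | zero => exact hy0
        | succ i => rw [(hw i).2.2, hi0, zero_smul]
      | succ j => exact ⟨_, j, (hw (i + j)).2.2⟩
    | h => exact ⟨_, j, (hw (i + j)).1⟩
  refine ⟨n, α, e, ⟨hpos, e0 ▸ h0, hh0, hy0, hxe, hlast, fun i h1 h2 hi => ?_, ?_⟩, ?_⟩
  · have htop := tail i (by omega) hi
    -- `x ^ (n - i)` kills the tail from `i` on. If that tail spanned the module, it would also kill
    -- `e 0`, whose image `e (n - i)` is nonzero by minimality of `n` because `i ≥ 1`.
    have hle : Submodule.span F (Set.range fun j => e (i + j)) ≤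
        LinearMap.ker (Algebra.lsmul F F M (gen q f g Gen.x ^ (n - i))) := by
      rw [Submodule.span_le]
      rintro _ ⟨j, rfl⟩
      change gen q f g Gen.x ^ (n - i) • e (i + j) = 0
      rw [hadd]
      exact chain_eq_zero hxe hlast (by omega)
    rw [htop] at hle
    have h3 : gen q f g Gen.x ^ (n - i) • e 0 = 0 := hle (Submodule.mem_top : e 0 ∈ ⊤)
    rw [hadd] at h3
    exact hmin _ (by omega) h3
  · simpa using tail 0 hpos (by rw [nu])
  · obtain ⟨m, hm⟩ := Nat.exists_eq_add_of_le' hpos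
    have := (hw m).2.2
    rw [← hm, hlast, smul_zero] at this
    exact (smul_eq_zero.1 this.symm).resolve_right (hmin m (by omega))

end Chain

/-! ### Injectivity of generators under isomorphism -/

section Transfer

variable {F : Type u} [Field F] {q : F} {f g : F[X]}
variable {M : Type*} [AddCommGroup M] [Module (Alg q f g) M]
variable {M' : Type*} [AddCommGroup M'] [Module (Alg q f g) M']

theorem gen_injective_congr (φ : M ≃ₗ[Alg q f g] M') (a : Gen) :
    (Function.Injective fun v : M => gen q f g a • v) ↔
      Function.Injective fun v : M' => gen q f g a • v := by
  constructor
  · intro h v w hvw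
    refine φ.symm.injective (h ?_)
    simpa only [map_smul] using congrArg φ.symm hvw
  · intro h v w hvw
    refine φ.injective (h ?_)
    simpa only [map_smul] using congrArg φ hvw

end Transfer

/-- Three alternatives that are told apart by two propositions. -/
theorem existsUnique_fin_three {P : Fin 3 → Prop} {a b : Prop} (h0 : P 0 → a) (h1 : P 1 → ¬ a ∧ b)
    (h2 : P 2 → ¬ a ∧ ¬ b) (h0' : a → P 0) (h1' : ¬ a → b → P 1) (h2' : ¬ a → ¬ b → P 2) :
    ∃! k, P k := by
  by_cases ha : a
  · refine ⟨0, h0' ha, fun k hk => ?_⟩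
    fin_cases k
    · rfl
    · exact absurd ha (h1 hk).1
    · exact absurd ha (h2 hk).1
  · by_cases hb : b
    · refine ⟨1, h1' ha hb, fun k hk => ?_⟩
      fin_cases k
      · exact absurd (h0 hk) ha
      · rfl
      · exact absurd hb (h2 hk).2
    · refine ⟨2, h2' ha hb, fun k hk => ?_⟩
      fin_cases k
      · exact absurd (h0 hk) ha
      · exact absurd (h1 hk).2 hb
      · rfl

end QGHA

/-! ### The classification -/

theorem theoremT {F : Type u} [Field F] [IsAlgClosed F] (q : F) (hq : q ≠ 0) (f g : F[X])
    (n : ℕ) (hn : 1 ≤ n) :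
    -- every module in the three lists is simple of dimension `n`
    (∀ (lam : QGHA.SF f) (mu : QGHA.TF q g lam) (γ : F), γ ≠ 0 →
      n = QGHA.lamPer lam.1 * QGHA.muPer lam.1 mu.1 →
      IsSimpleModule (QGHA.Alg q f g) (QGHA.QuoA lam mu γ) ∧
        Module.finrank F (QGHA.QuoA lam mu γ) = n) ∧
    (∀ (lam : QGHA.SF f) (mu : QGHA.TF q g lam) (γ : F), γ ≠ 0 →
      n = QGHA.lamPer lam.1 * QGHA.muPer lam.1 mu.1 →
      (∃ i : ℕ, i < QGHA.lamPer lam.1 * QGHA.muPer lam.1 mu.1 ∧ mu.1 i = 0) →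
      IsSimpleModule (QGHA.Alg q f g) (QGHA.QuoB lam mu γ) ∧
        Module.finrank F (QGHA.QuoB lam mu γ) = n) ∧
    (∀ (α : F) (hα : QGHA.nu q f g α n = 0),
      (∀ i : ℕ, 1 ≤ i → i ≤ n - 1 → QGHA.nu q f g α i ≠ 0) →
      IsSimpleModule (QGHA.Alg q f g) (QGHA.QuoC hα) ∧
        Module.finrank F (QGHA.QuoC hα) = n) ∧
    -- every simple `n`-dimensional module occurs in exactly one of the three lists
    (∀ (M : Type v) [AddCommGroup M] [Module F M] [Module (QGHA.Alg q f g) M]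
        [IsScalarTower F (QGHA.Alg q f g) M],
      IsSimpleModule (QGHA.Alg q f g) M → Module.finrank F M = n →
      ∃! k : Fin 3, ![
        ∃ (lam : QGHA.SF f) (mu : QGHA.TF q g lam) (γ : F), γ ≠ 0 ∧
          n = QGHA.lamPer lam.1 * QGHA.muPer lam.1 mu.1 ∧
          Nonempty (M ≃ₗ[QGHA.Alg q f g] QGHA.QuoA lam mu γ),
        ∃ (lam : QGHA.SF f) (mu : QGHA.TF q g lam) (γ : F), γ ≠ 0 ∧
          n = QGHA.lamPer lam.1 * QGHA.muPer lam.1 mu.1 ∧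
          (∃ i : ℕ, i < QGHA.lamPer lam.1 * QGHA.muPer lam.1 mu.1 ∧ mu.1 i = 0) ∧
          Nonempty (M ≃ₗ[QGHA.Alg q f g] QGHA.QuoB lam mu γ),
        ∃ (α : F) (hα : QGHA.nu q f g α n = 0),
          (∀ i : ℕ, 1 ≤ i → i ≤ n - 1 → QGHA.nu q f g α i ≠ 0) ∧
          Nonempty (M ≃ₗ[QGHA.Alg q f g] QGHA.QuoC hα)] k) ∧
    -- inside each list, the parameters are unique, up to a simultaneous shift of `λ` and `μ`
    (∀ (lam lam' : QGHA.SF f) (mu : QGHA.TF q g lam) (mu' : QGHA.TF q g lam') (γ γ' : F),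
      γ ≠ 0 → γ' ≠ 0 →
      n = QGHA.lamPer lam.1 * QGHA.muPer lam.1 mu.1 →
      n = QGHA.lamPer lam'.1 * QGHA.muPer lam'.1 mu'.1 →
      (Nonempty (QGHA.QuoA lam mu γ ≃ₗ[QGHA.Alg q f g] QGHA.QuoA lam' mu' γ') ↔
        γ = γ' ∧ ∃ j : ℤ, ∀ i : ℤ, lam'.1 i = lam.1 (i + j) ∧ mu'.1 i = mu.1 (i + j))) ∧
    (∀ (lam lam' : QGHA.SF f) (mu : QGHA.TF q g lam) (mu' : QGHA.TF q g lam') (γ γ' : F),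
      γ ≠ 0 → γ' ≠ 0 →
      n = QGHA.lamPer lam.1 * QGHA.muPer lam.1 mu.1 →
      n = QGHA.lamPer lam'.1 * QGHA.muPer lam'.1 mu'.1 →
      (∃ i : ℕ, i < QGHA.lamPer lam.1 * QGHA.muPer lam.1 mu.1 ∧ mu.1 i = 0) →
      (∃ i : ℕ, i < QGHA.lamPer lam'.1 * QGHA.muPer lam'.1 mu'.1 ∧ mu'.1 i = 0) →
      (Nonempty (QGHA.QuoB lam mu γ ≃ₗ[QGHA.Alg q f g] QGHA.QuoB lam' mu' γ') ↔
        γ = γ' ∧ ∃ j : ℤ, ∀ i : ℤ, lam'.1 i = lam.1 (i + j) ∧ mu'.1 i = mu.1 (i + j))) ∧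
    (∀ (α α' : F) (hα : QGHA.nu q f g α n = 0) (hα' : QGHA.nu q f g α' n = 0),
      (∀ i : ℕ, 1 ≤ i → i ≤ n - 1 → QGHA.nu q f g α i ≠ 0) →
      (∀ i : ℕ, 1 ≤ i → i ≤ n - 1 → QGHA.nu q f g α' i ≠ 0) →
      (Nonempty (QGHA.QuoC hα ≃ₗ[QGHA.Alg q f g] QGHA.QuoC hα') ↔ α = α')) := by
  have pos : ∀ {lam mu : ℤ → F}, n = QGHA.lamPer lam * QGHA.muPer lam mu →
      0 < QGHA.per lam mu := fun h => hn.trans_eq h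
  have famA := fun (lam : QGHA.SF f) (mu : QGHA.TF q g lam) (γ : F) (hγ : γ ≠ 0)
    (h : n = QGHA.lamPer lam.1 * QGHA.muPer lam.1 mu.1) =>
      (h ▸ QGHA.weightCycle_quoA lam mu hγ (pos h) : QGHA.WeightCycle q f g n lam.1 mu.1 γ
        fun i => (Submodule.Quotient.mk (QGHA.monA lam mu i) : QGHA.QuoA lam mu γ))
  have famB := fun (lam : QGHA.SF f) (mu : QGHA.TF q g lam) (γ : F) (hγ : γ ≠ 0)
    (h : n = QGHA.lamPer lam.1 * QGHA.muPer lam.1 mu.1) =>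
      (h ▸ QGHA.weightCycle_quoB lam mu hγ (pos h) : QGHA.WeightCycle q f g n lam.1 mu.1 γ
        fun i => (Submodule.Quotient.mk (QGHA.monB lam mu i) : QGHA.QuoB lam mu γ))
  have famC := fun (α : F) (hα : QGHA.nu q f g α n = 0) h => QGHA.nilChain_quoC hn hα h
  refine ⟨fun lam mu γ hγ h => ?_, fun lam mu γ hγ h _ => ?_, fun α hα h => ?_, ?_,
    fun lam lam' mu mu' γ γ' hγ hγ' h h' => ?_, fun lam lam' mu mu' γ γ' hγ hγ' h h' _ _ => ?_,
    fun α α' hα hα' h h' => (famC α hα h).nonempty_equiv_iff (famC α' hα' h')⟩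
  · exact ⟨(famA lam mu γ hγ h).simple_of_x (QGHA.x_smul_quoA lam mu γ),
      (famA lam mu γ hγ h).finrank_eq⟩
  · exact ⟨(famB lam mu γ hγ h).simple_of_y (QGHA.y_smul_quoB lam mu γ),
      (famB lam mu γ hγ h).finrank_eq⟩
  · exact ⟨(famC α hα h).simple, (famC α hα h).finrank_eq⟩
  · intro M _ _ _ _ hM hdim
    have : FiniteDimensional F M := Module.finite_of_finrank_pos (by omega)
    have : Nontrivial M := IsSimpleModule.nontrivial (QGHA.Alg q f g) M
    -- Injectivity of `x` and of `y` is invariant under isomorphism and decides the list, which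
    -- gives existence and exclusivity at once.
    refine QGHA.existsUnique_fin_three
      (a := Function.Injective fun v : M => QGHA.gen q f g QGHA.Gen.x • v)
      (b := Function.Injective fun v : M => QGHA.gen q f g QGHA.Gen.y • v) ?_ ?_ ?_ ?_ ?_ ?_
    · rintro ⟨lam, mu, γ, hγ, h, ⟨φ⟩⟩
      exact (QGHA.gen_injective_congr φ _).2
        ((famA lam mu γ hγ h).x_injective (QGHA.x_smul_quoA lam mu γ))
    · rintro ⟨lam, mu, γ, hγ, h, ⟨i, -, hi⟩, ⟨φ⟩⟩
      rw [QGHA.gen_injective_congr φ, QGHA.gen_injective_congr φ]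
      exact ⟨(famB lam mu γ hγ h).x_not_injective (QGHA.y_smul_quoB lam mu γ) hi,
        (famB lam mu γ hγ h).y_injective (QGHA.y_smul_quoB lam mu γ)⟩
    · rintro ⟨α, hα, h, ⟨φ⟩⟩
      rw [QGHA.gen_injective_congr φ, QGHA.gen_injective_congr φ]
      exact ⟨(famC α hα h).x_not_injective, (famC α hα h).y_not_injective⟩
    · intro hx
      obtain ⟨lam, hl, mu, hm, γ, e, he, hxe⟩ := QGHA.exists_weightCycle_of_x_injective hx
      have h : n = QGHA.per lam mu := hdim.symm.trans he.finrank_eq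
      exact ⟨⟨lam, hl⟩, ⟨mu, hm⟩, γ, he.gamma_ne_zero, h,
        he.nonempty_equiv_of_x hxe
          (QGHA.weightCycle_quoA ⟨lam, hl⟩ ⟨mu, hm⟩ he.gamma_ne_zero he.pos)
          (QGHA.x_smul_quoA _ _ γ)⟩
    · intro hx hy
      obtain ⟨lam, hl, mu, hm, γ, e, he, hye⟩ := QGHA.exists_weightCycle_of_y_injective hy
      have h : n = QGHA.per lam mu := hdim.symm.trans he.finrank_eq
      exact ⟨⟨lam, hl⟩, ⟨mu, hm⟩, γ, he.gamma_ne_zero, h, he.exists_mu_eq_zero hye hx,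
        he.nonempty_equiv_of_y hye
          (QGHA.weightCycle_quoB ⟨lam, hl⟩ ⟨mu, hm⟩ he.gamma_ne_zero he.pos)
          (QGHA.y_smul_quoB _ _ γ)⟩
    · intro hx hy
      obtain ⟨m, α, e, he, hα⟩ := QGHA.exists_nilChain hx hy
      obtain rfl : m = n := he.finrank_eq.symm.trans hdim
      exact ⟨α, hα, he.nu_ne_zero, he.nonempty_equiv (famC α hα he.nu_ne_zero)⟩
  · exact (famA lam mu γ hγ h).nonempty_equiv_iff_of_x (famA lam' mu' γ' hγ' h') lam.2 lam'.2
      mu.2 mu'.2 (QGHA.x_smul_quoA lam mu γ) (QGHA.x_smul_quoA lam' mu' γ')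
  · exact (famB lam mu γ hγ h).nonempty_equiv_iff_of_y (famB lam' mu' γ' hγ' h') lam.2 lam'.2
      mu.2 mu'.2 (QGHA.y_smul_quoB lam mu γ) (QGHA.y_smul_quoB lam' mu' γ')
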